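/- **Conventions.** All groups below are finite. For a group $U$, $\mathrm{soc}(U)$ is the subgroup generated by the minimal normal subgroups of $U$. Let $F$ be a field of characteristic $0$. A *map* $f:X\to X_0$ is a finite dominant $F$-morphism of normal irreducible (integral, separated, finite type) varieties over $F$ (smooth projective irreducible varieties are a special case); $\deg f=[F(X):F(X_0)]$. A *decomposition* $f=g\circ h$ consists of maps $h:X\to Y$, $g:Y\to X_0$ with $Y$ normal and irreducible. The *monodromy group* $\mathrm{Mon}(f)$ is the Galois group of the Galois closure of $F(X)/F(X_0)$, i.e. the image of the absolute Galois group of $F(X_0)$ in the permutations of the geometric generic fibre of $f$. For $f=g\circ h$, let $J$ be the geometric generic fibre of $g$, $m=\deg g=\#J$ and $U=\mathrm{Mon}(h)$. The kernel $K$ of the projection $\mathrm{Mon}(f)\to\mathrm{Mon}(g)$ acts on the fibre of $h$ over each $j\in J$, which identifies $K$ with a subgroup of $U^J$ (with one copy $U_j$ of $U$ for each $j\in J$). * $g\circ h$ is *invariant* if for every decomposition $g\circ h=g_1\circ h_1$ with $\deg h_1>1$ there are a map $w$ with $\deg w>1$ and maps $a,b$ such that $h=a\circ w$ and $h_1=b\circ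 w$. * $g\circ h$ is *Galois-proper* if $\deg g,\deg h>1$ and the kernel of $\mathrm{Mon}(g\circ h)\to\mathrm{Mon}(g)$ is nontrivial. * Suppose $\mathrm{soc}(U)$ is a nonabelian minimal normal subgroup of $U$, so that $\mathrm{soc}(U)=L^I$ with $L$ nonabelian simple and $\mathrm{soc}(U)^J=L^{I\times J}$. Let $P$ be the partition of $I\times J$ such that $K\cap L^p\cong L$ for every block $p\in P$ and $\mathrm{soc}(K)=K\cap\mathrm{soc}(U)^J=\prod_{p\in P}(K\cap L^p)$ (if $K\ne1$, exactly one such $P$ exists). Then $g\circ h$ is *conjugation-compatible* if the images of the blocks of $P$ under the projection $I\times J\to J$ form a partition of $J$. **Theorem.** Let $f=g\circ h$ be an invariant, conjugation-compatible decomposition of maps over $F$ such that $\mathrm{soc}(U)$ is a nonabelian minimal normal subgroup of $U=\mathrm{Mon}(h)$. Suppose that for every decomposition $g=g_1\circ g_2$ with $\deg g_2>1$, the decomposition $g_2\circ h$ is Galois-proper and $\mathrm{Mon}(g_2\circ h)$ does not embed in $\mathrm{Aut}(\mathrm{soc}(U))$. Then the kernel $K\le U^{J}$ of $\mathrm{Mon}(f)\to\mathrm{Mon}(g)$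 contains $\mathrm{soc}(U)^{J}\cong\mathrm{soc}(U)^{\deg g}$. **Field version.** Let $L/F$ be a finite extension of fields of characteristic $0$ and $F\subseteq E\subseteq L$ an intermediate field. Let $U$, $V$, $G$ be the Galois groups of the Galois closures of $L/E$, $E/F$, $L/F$, let $J$ be the set of embeddings of $E$ over $F$ into an algebraic closure, and regard $K=\ker(G\to V)$ as a subgroup of $U^J$ as above. Assume that (i) $E$ is invariant: the compositum $E\cdot M$ is a proper subfield of $L$ for every proper intermediate field $M\subsetneq L$ of $L/F$; (ii) $\mathrm{soc}(U)$ is a nonabelian minimal normal subgroup of $U$; (iii) $E$ is conjugation-compatible, i.e. the images in $J$ of the blocks of the partition $P$ of $I\times J$ attached to $K$ as above form a partition of $J$; (iv) for every intermediate field $F\subseteq M\subsetneq E$, the Galois closure of $E/M$ is a proper subfield of the Galois closure of $L/M$, and the Galois group of the Galois closure of $L/M$ does not embed in $\mathrm{Aut}(\mathrm{soc}(U))$. Then $K$ contains $\mathrm{soc}(U)^{J}\cong\mathrm{soc}(U)^{[E:F]}$. -/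

import Mathlib

open CategoryTheory AlgebraicGeometry

universe u v

noncomputable section

namespace MonDec

/-! ### Socles -/

/-- Minimal normal subgroups: minimal among the nontrivial normal subgroups. -/
def IsMinimalNormal {G : Type*} [Group G] (N : Subgroup G) : Prop :=
  Minimal (fun M : Subgroup G => M.Normal ∧ M ≠ ⊥) N

/-- The socle: the subgroup generated by all minimal normal subgroups. -/
def socle (G : Type*) [Group G] : Subgroup G :=
  sSup {N : Subgroup G | IsMinimalNormal N}

/-- The socle of `G` is a nonabelian minimal normal subgroup of `G`. -/
def SocleNonabelianMinimalNormal (G : Type*) [Group G] : Prop :=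
  IsMinimalNormal (socle G) ∧ ∃ a ∈ socle G, ∃ b ∈ socle G, a * b ≠ b * a

/-- There is an injective homomorphism from `G` to `H`. -/
def EmbedsIn (G H : Type*) [Group G] [Group H] : Prop :=
  ∃ φ : G →* H, Function.Injective φ

/-! ### Subgroups of a product of groups

`U j`, for `j : J`, is a family of groups (below: isomorphic copies of one group `U`, so that
`∀ j, U j` is the power of `U` indexed by `J`), and `K` is a subgroup of the product. -/

/-- The minimal normal subgroups of `soc(G)`. If `soc(G)` is a nonabelian minimal normal
subgroup of the finite group `G`, these are the simple factors of the decomposition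
`soc(G) = L ^ I`, and this type is the index set `I`. -/
def SimpleFactor (G : Type*) [Group G] : Type _ :=
  {S : Subgroup (socle G) // IsMinimalNormal S}

section Product

variable {J : Type*} (U : J → Type*) [∀ j, Group (U j)]

/-- The product of the socles, as a subgroup of the product. -/
def soclePower : Subgroup (∀ j, U j) :=
  Subgroup.pi Set.univ fun j => socle (U j)

/-- `K` is large: it contains the product of all the socles. -/
def IsLarge (K : Subgroup (∀ j, U j)) : Prop :=
  soclePower U ≤ K

/-- The index set `I × J` of all the simple factors in the decomposition
`soc(U) ^ J = L ^ (I × J)`. -/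
abbrev FactorIndex : Type _ := Σ j, SimpleFactor (U j)

open Classical in
/-- The simple factor with a given index, as a subgroup of the product. -/
def factor (s : FactorIndex U) : Subgroup (∀ j, U j) :=
  (s.2.1.map (socle (U s.1)).subtype).map (MonoidHom.mulSingle U s.1)

/-- `L ^ p`: the product of the simple factors whose index lies in `p`. -/
def factorPower (p : Set (FactorIndex U)) : Subgroup (∀ j, U j) :=
  ⨆ s ∈ p, factor U s

/-- `P` is a partition of `I × J` such that `K ∩ L ^ p ≅ L` for every block `p` of `P`, and
`soc(K) = K ∩ soc(U) ^ J` is the product of these groups. -/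
structure IsSoclePartition (K : Subgroup (∀ j, U j)) (P : Setoid (FactorIndex U)) : Prop where
  block_equiv : ∀ p ∈ P.classes, ∀ s ∈ p, Nonempty (↥(K ⊓ factorPower U p) ≃* ↥s.2.1)
  socle_eq : (socle K).map K.subtype = K ⊓ soclePower U
  prod_eq : ⨆ p ∈ P.classes, K ⊓ factorPower U p = K ⊓ soclePower U

/-- The partition of `I × J` determined by `K` is compatible with the partition into the sets
`I × {j}`: the images in `J` of its blocks form a partition of `J`. For the kernels considered
below there is exactly one partition `P` as in `IsSoclePartition`. -/
def IsConjCompatible (K : Subgroup (∀ j, U j)) : Prop :=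
  ∀ P : Setoid (FactorIndex U), IsSoclePartition U K P →
    Setoid.IsPartition {q : Set J | ∃ p ∈ P.classes, q = Sigma.fst '' p}

end Product

/-- If `A` is the disjoint union of sets `B j`, then the product of permutation groups on the
`B j` acts on `A`. -/
def blockHom {J A : Type*} {B : J → Type*} (e : (Σ j, B j) ≃ A)
    (U : ∀ j, Subgroup (Equiv.Perm (B j))) : (∀ j, U j) →* Equiv.Perm A :=
  e.permCongrHom.toMonoidHom.comp
    ((Equiv.Perm.sigmaCongrRightHom B).comp
      (MonoidHom.pi fun j => (U j).subtype.comp (Pi.evalMonoidHom (fun j => U j) j)))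

/-! ### Maps of varieties -/

/-- Integral normal schemes. -/
class IsNormalIntegral (X : Scheme.{u}) : Prop extends IsIntegral X where
  normal : ∀ x : X, IsIntegrallyClosed (X.presheaf.stalk x)

/-- The degree of a dominant morphism `f : X ⟶ Y` of integral schemes: the degree of the extension
of function fields. The local ring of `Y` at the image of the generic point of `X` is the
function field of `Y`. -/
def degree {X Y : Scheme.{u}} [IsIntegral X] (f : X ⟶ Y) : ℕ :=
  letI := (f.stalkMap (genericPoint X)).hom.toAlgebra
  Module.finrank (Y.presheaf.stalk (f (genericPoint X))) X.functionField

/-- The spectrum of an algebraic closure of the function field of `X`. -/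
abbrev geomGenericSpec (X : Scheme.{u}) [IsIntegral X] : Scheme.{u} :=
  Spec (.of (AlgebraicClosure X.functionField))

/-- The geometric generic point of `X`. -/
def geomGenericPoint (X : Scheme.{u}) [IsIntegral X] : geomGenericSpec X ⟶ X :=
  Spec.map (CommRingCat.ofHom (algebraMap X.functionField (AlgebraicClosure X.functionField))) ≫
    X.fromSpecStalk (genericPoint X)

section Scheme

variable {T X Y X₀ : Scheme.{u}}

/-- The fibre of `f` over the `T`-valued point `x`. -/
def Fib (f : X ⟶ X₀) (x : T ⟶ X₀) : Type u := {p : T ⟶ X // p ≫ f = x}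

/-- The automorphisms of `T` over `x`. If `x` is a geometric generic point of `X₀`, this is the
absolute Galois group of the function field of `X₀`. -/
def ptAut (x : T ⟶ X₀) : Subgroup (Aut T) where
  carrier := {σ | σ.inv ≫ x = x}
  one_mem' := Category.id_comp x
  mul_mem' {σ τ} hσ hτ := by
    have hσ' : σ.inv ≫ x = x := hσ
    have hτ' : τ.inv ≫ x = x := hτ
    change (σ.inv ≫ τ.inv) ≫ x = x
    rw [Category.assoc, hτ', hσ']
  inv_mem' {σ} hσ := by
    have hσ' : σ.inv ≫ x = x := hσ
    change σ.hom ≫ x = x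
    conv_lhs => rw [← hσ']
    exact Iso.hom_inv_id_assoc σ x

/-- The action of the automorphisms of `T` over `x` on the fibre of `f` over `x`. -/
def fibAction (f : X ⟶ X₀) (x : T ⟶ X₀) : ptAut x →* Equiv.Perm (Fib f x) :=
  letI : MulAction (ptAut x) (Fib f x) :=
    { smul := fun σ p => ⟨σ.1.inv ≫ p.1, by
        rw [Category.assoc, p.2]; exact σ.2⟩
      one_smul := fun p => Subtype.ext (Category.id_comp p.1)
      mul_smul := fun σ τ p => Subtype.ext (Category.assoc σ.1.inv τ.1.inv p.1) }
  MulAction.toPermHom (ptAut x) (Fib f x)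

/-- The monodromy group of `f`, as a group of permutations of the fibre over `x`. -/
def monodromyGroup (f : X ⟶ X₀) (x : T ⟶ X₀) : Subgroup (Equiv.Perm (Fib f x)) :=
  (fibAction f x).range

/-- The kernel of the projection `Mon(g ∘ h) → Mon(g)`, as a group of permutations of the fibre of
`g ∘ h`: the automorphisms over `x` that act trivially on the fibre of `g`, in their action on the
fibre of `g ∘ h`. -/
def monKer (h : X ⟶ Y) (g : Y ⟶ X₀) (x : T ⟶ X₀) : Subgroup (Equiv.Perm (Fib (h ≫ g) x)) :=
  (fibAction g x).ker.map (fibAction (h ≫ g) x)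

/-- The fibre of `g ∘ h` is the disjoint union of the fibres of `h` over the points of the fibre
of `g`. -/
def fibEquiv (h : X ⟶ Y) (g : Y ⟶ X₀) (x : T ⟶ X₀) :
    (Σ j : Fib g x, Fib h j.1) ≃ Fib (h ≫ g) x where
  toFun s := ⟨s.2.1, by rw [← Category.assoc, s.2.2, s.1.2]⟩
  invFun p := ⟨⟨p.1 ≫ h, by rw [Category.assoc, p.2]⟩, ⟨p.1, rfl⟩⟩
  left_inv := by rintro ⟨⟨j, hj⟩, ⟨p, hp⟩⟩; cases hp; rfl
  right_inv _ := rfl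

/-- The kernel of `Mon(g ∘ h) → Mon(g)`, as a subgroup of the product of the groups `Mon(h)`,
over all points of the fibre of `g`. -/
def monKerPi (h : X ⟶ Y) (g : Y ⟶ X₀) (x : T ⟶ X₀) :
    Subgroup (∀ j : Fib g x, monodromyGroup h j.1) :=
  (monKer h g x).comap (blockHom (fibEquiv h g x) fun j => monodromyGroup h j.1)

/-- `g ∘ h` is proper, and `Mon(g ∘ h) → Mon(g)` has a nontrivial kernel. -/
def IsGaloisProper [IsIntegral X] [IsIntegral Y] (h : X ⟶ Y) (g : Y ⟶ X₀) (x : T ⟶ X₀) : Prop :=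
  1 < degree h ∧ 1 < degree g ∧ monKer h g x ≠ ⊥

end Scheme

/-- `g ∘ h` is invariant: for every decomposition `g ∘ h = g₁ ∘ h₁` with `deg h₁ > 1`, the maps `h`
and `h₁` have a common right composition factor `w` of degree greater than `1`. -/
def IsInvariantDecomp {X Y X₀ : Scheme.{u}} [IsIntegral X] (h : X ⟶ Y) (g : Y ⟶ X₀) : Prop :=
  ∀ (Y₁ : Scheme.{u}) [IsNormalIntegral Y₁] (h₁ : X ⟶ Y₁) (g₁ : Y₁ ⟶ X₀)
    [IsFinite h₁] [IsDominant h₁] [IsFinite g₁] [IsDominant g₁],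
    h₁ ≫ g₁ = h ≫ g → 1 < degree h₁ →
    ∃ (W : Scheme.{u}) (_ : IsNormalIntegral W) (w : X ⟶ W) (a : W ⟶ Y) (b : W ⟶ Y₁),
      IsFinite w ∧ IsDominant w ∧ IsFinite a ∧ IsDominant a ∧ IsFinite b ∧ IsDominant b ∧
      w ≫ a = h ∧ w ≫ b = h₁ ∧ 1 < degree w

/-! ### Towers of fields

The same notions for ring homomorphisms of fields in place of morphisms of schemes. -/

section Field

variable {K M N Ω : Type*} [Field K] [Field M] [Field N] [Field Ω]

/-- The embeddings of `M` into `Ω` that extend the embedding `x` of `K`. -/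
def Emb (i : K →+* M) (x : K →+* Ω) : Type _ := {p : M →+* Ω // p.comp i = x}

/-- The group of automorphisms of `Ω` over (the image of) `K`. -/
def galGroup (x : K →+* Ω) : Subgroup (RingAut Ω) where
  carrier := {σ | ∀ a, σ (x a) = x a}
  one_mem' _ := rfl
  mul_mem' {σ τ} hσ hτ a := by
    change σ (τ (x a)) = x a
    rw [hτ a, hσ a]
  inv_mem' {σ} hσ a := by
    change σ.symm (x a) = x a
    rw [RingEquiv.symm_apply_eq]
    exact (hσ a).symm

/-- The action of the automorphisms of `Ω` over `K` on the embeddings of `M` over `K`. -/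
def embAction (i : K →+* M) (x : K →+* Ω) : galGroup x →* Equiv.Perm (Emb i x) :=
  letI : MulAction (galGroup x) (Emb i x) :=
    { smul := fun σ p => ⟨(σ.1 : Ω →+* Ω).comp p.1, by
        rw [RingHom.comp_assoc, p.2]; exact RingHom.ext σ.2⟩
      one_smul := fun _ => rfl
      mul_smul := fun _ _ _ => rfl }
  MulAction.toPermHom (galGroup x) (Emb i x)

/-- The Galois group of the Galois closure of `M / K`, as a group of permutations of the embeddings
of `M` into `Ω` over `K`. -/
def galoisGroup (i : K →+* M) (x : K →+* Ω) : Subgroup (Equiv.Perm (Emb i x)) :=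
  (embAction i x).range

/-- The Galois closure of `M / K` in `Ω`: the subfield generated by all conjugates of `M`. -/
def galClosure (i : K →+* M) (x : K →+* Ω) : Subfield Ω :=
  ⨆ p : Emb i x, p.1.fieldRange

/-- The kernel of the projection from the Galois group of the Galois closure of `N / K` to that of
`M / K`. -/
def galKer (g : K →+* M) (h : M →+* N) (x : K →+* Ω) :
    Subgroup (Equiv.Perm (Emb (h.comp g) x)) :=
  (embAction g x).ker.map (embAction (h.comp g) x)

/-- Embeddings of `N` over `K`, sorted by their restrictions to `M`. -/
def embEquiv (g : K →+* M) (h : M →+* N) (x : K →+* Ω) :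
    (Σ j : Emb g x, Emb h j.1) ≃ Emb (h.comp g) x where
  toFun s := ⟨s.2.1, by rw [← RingHom.comp_assoc, s.2.2, s.1.2]⟩
  invFun p := ⟨⟨p.1.comp h, by rw [RingHom.comp_assoc, p.2]⟩, ⟨p.1, rfl⟩⟩
  left_inv := by rintro ⟨⟨j, hj⟩, ⟨p, hp⟩⟩; cases hp; rfl
  right_inv _ := rfl

/-- The kernel `galKer`, as a subgroup of the product of the Galois groups of the Galois closures of
`N / M`, over all embeddings of `M` over `K`. -/
def galKerPi (g : K →+* M) (h : M →+* N) (x : K →+* Ω) :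
    Subgroup (∀ j : Emb g x, galoisGroup h j.1) :=
  (galKer g h x).comap (blockHom (embEquiv g h x) fun j => galoisGroup h j.1)

end Field

/-- The intermediate field `E` of `L / F` is invariant: its compositum with every proper
intermediate field is a proper subfield of `L`. -/
def IsInvariantIntermediate {F : Type u} {L : Type v} [Field F] [Field L] [Algebra F L]
    (E : IntermediateField F L) : Prop :=
  ∀ M : IntermediateField F L, M ≠ ⊤ → E ⊔ M ≠ ⊤

end MonDec

end

open MonDec

noncomputable section

namespace MonDec

/-! ### Minimal normal subgroups and socles of finite groups -/

section Socle

variable {G H : Type*} [Group G] [Group H]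

/-! The heart is a statement on permutation groups, `isLarge_of_blocks`, applied once to Galois
actions on embeddings and once to automorphisms of a geometric generic point acting on fibres. A
group acts transitively on a set with blocks indexed by `J`, the stabilizer of a block induces `U j`
on it, and `K` is the kernel on blocks. Conjugation makes the group act on the product of the `U j`,
permuting coordinates as it permutes `J`.

A nontrivial invariant subgroup of the product projects to a nontrivial normal subgroup of each `U
j`, which contains the socle. This applies to `K`, and a centralizer argument then puts soc(K)
inside the product of the socles; being characteristic in `K`, soc(K) is invariant too, so it
projects onto every socle.

Suppose two coordinates vanish on the same elements of N = soc(K). The elements preserving the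
kernel of N → soc(U j₀) form a group H strictly larger than the stabilizer of j₀, and H acts on N
modulo that kernel, that is on soc(U j₀). If the kernel R of this action fixes a point α of block
j₀, then the group induced by H on the orbit of α embeds in Aut(soc U), which is excluded. Otherwise
Stab(α)·R is strictly larger than Stab(α), so invariance provides an element of it that preserves
block j₀ and moves α. Its R-component acts on block j₀ by an element of U j₀ centralizing the socle,
hence trivially: a contradiction (`not_coordinates_equivalent`).

It remains to exclude diagonal subgroups involving only some of the simple factors over different
coordinates. Linking two factors when they have the same centralizer in N gives the partition
attached to `K`, by a Goursat argument for nonabelian simple factors. Conjugation compatibility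
upgrades a link between factors over two coordinates to equivalence of the coordinates themselves,
which was excluded; linked factors over one coordinate coincide. So all blocks are singletons and
every simple factor lies in `K` (`isLarge_of_forall_ne`).

The hypotheses are translated by the Galois correspondence: a group between Stab(α) and the whole
group is the group of an intermediate field (`galGroup_fixedSubfield`), and for varieties an
intermediate field is the function field of a normalization (`exists_factorization`). -/

theorem IsMinimalNormal.normal {M : Subgroup G} (h : IsMinimalNormal M) : M.Normal := h.prop.1

theorem IsMinimalNormal.ne_bot {M : Subgroup G} (h : IsMinimalNormal M) : M ≠ ⊥ := h.prop.2

theorem IsMinimalNormal.eq_of_le {M X : Subgroup G} (h : IsMinimalNormal M) (hX : X.Normal)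
    (hb : X ≠ ⊥) (hle : X ≤ M) : X = M :=
  le_antisymm hle (h.le_of_le ⟨hX, hb⟩ hle)

theorem exists_isMinimalNormal_le [Finite G] {X : Subgroup G} (hX : X.Normal) (hb : X ≠ ⊥) :
    ∃ M ≤ X, IsMinimalNormal M := by
  obtain ⟨M, hM, hmin⟩ := exists_minimal_le_of_wellFoundedLT
    (fun M : Subgroup G => M.Normal ∧ M ≠ ⊥) X ⟨hX, hb⟩
  exact ⟨M, hM, hmin⟩

theorem IsMinimalNormal.le_socle {M : Subgroup G} (h : IsMinimalNormal M) : M ≤ socle G :=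
  le_sSup h

theorem IsMinimalNormal.map_equiv {M : Subgroup G} (h : IsMinimalNormal M) (e : G ≃* H) :
    IsMinimalNormal (M.map e.toMonoidHom) := by
  have := h.normal
  refine ⟨⟨h.normal.map _ e.surjective, ?_⟩, ?_⟩
  · rw [Ne, Subgroup.map_eq_bot_iff_of_injective _ e.injective]
    exact h.ne_bot
  · rintro X ⟨hX, hb⟩ hle
    have hX' : (X.comap e.toMonoidHom).Normal := hX.comap _
    have hb' : X.comap e.toMonoidHom ≠ ⊥ := by
      intro h0
      apply hb
      rw [← Subgroup.map_comap_eq_self_of_surjective (f := e.toMonoidHom) e.surjective X, h0,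
        Subgroup.map_bot]
    have hle' : X.comap e.toMonoidHom ≤ M := by
      rw [← Subgroup.comap_map_eq_self_of_injective (f := e.toMonoidHom) e.injective M]
      exact Subgroup.comap_mono hle
    have := h.eq_of_le hX' hb' hle'
    rw [← this, Subgroup.map_comap_eq_self_of_surjective (f := e.toMonoidHom) e.surjective X]

theorem map_socle_le (e : G ≃* H) : (socle G).map e.toMonoidHom ≤ socle H := by
  rw [socle, sSup_eq_iSup, Subgroup.map_iSup]
  refine iSup_le fun M => ?_
  rw [Subgroup.map_iSup]
  exact iSup_le fun hM => (IsMinimalNormal.map_equiv hM e).le_socle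

theorem map_socle (e : G ≃* H) : (socle G).map e.toMonoidHom = socle H := by
  refine le_antisymm (map_socle_le e) ?_
  intro x hx
  refine ⟨e.symm x, map_socle_le e.symm ⟨x, hx, rfl⟩, by simp⟩

instance socle_characteristic : (socle G).Characteristic :=
  Subgroup.characteristic_iff_map_eq.mpr fun e => map_socle e

theorem SocleNonabelianMinimalNormal.map_equiv (h : SocleNonabelianMinimalNormal G) (e : G ≃* H) :
    SocleNonabelianMinimalNormal H := by
  obtain ⟨h1, a, ha, b, hb, hab⟩ := h
  refine ⟨map_socle e ▸ h1.map_equiv e, e a, map_socle_le e ⟨a, ha, rfl⟩, e b,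
    map_socle_le e ⟨b, hb, rfl⟩, ?_⟩
  rw [← map_mul, ← map_mul]
  exact fun h0 => hab (e.injective h0)

variable [Finite G]

/-- By finiteness `X` contains a minimal normal subgroup; it lies in the socle, which is itself
minimal, so it is the socle. -/
theorem SocleNonabelianMinimalNormal.socle_le (h : SocleNonabelianMinimalNormal G)
    {X : Subgroup G} (hX : X.Normal) (hb : X ≠ ⊥) : socle G ≤ X := by
  obtain ⟨M, hM, hmin⟩ := exists_isMinimalNormal_le hX hb
  rw [← h.1.eq_of_le hmin.normal hmin.ne_bot hmin.le_socle]
  exact hM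

/-- The centralizer of the socle is normal; if it were nontrivial it would contain the socle and
make it abelian. -/
theorem SocleNonabelianMinimalNormal.eq_one_of_commute (h : SocleNonabelianMinimalNormal G)
    {x : G} (hx : ∀ s ∈ socle G, s * x = x * s) : x = 1 := by
  by_contra hne
  have hb : Subgroup.centralizer (socle G : Set G) ≠ ⊥ := by
    intro h0
    have : x ∈ Subgroup.centralizer (socle G : Set G) := Subgroup.mem_centralizer_iff.mpr hx
    rw [h0] at this
    exact hne this
  have hle := h.socle_le (X := Subgroup.centralizer (socle G : Set G)) inferInstance hb
  obtain ⟨a, ha, b, hb, hab⟩ := h.2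
  exact hab (Subgroup.mem_centralizer_iff.mp (hle hb) a ha)

omit [Finite G] in
/-- Minimal normal subgroups of a group that are distinct commute. -/
theorem IsMinimalNormal.commute_of_ne {M M' : Subgroup G} (h : IsMinimalNormal M)
    (h' : IsMinimalNormal M') (hne : M ≠ M') {x y : G} (hx : x ∈ M) (hy : y ∈ M') :
    Commute x y := by
  have hn := h.normal
  have hn' := h'.normal
  refine Subgroup.commute_of_normal_of_disjoint M M' hn hn' ?_ x y hx hy
  rw [disjoint_iff]
  by_contra hb
  have h1 := h.eq_of_le (X := M ⊓ M') inferInstance hb inf_le_left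
  have h2 := h'.eq_of_le (X := M ⊓ M') inferInstance hb inf_le_right
  exact hne (h1.symm.trans h2)

/-- The inner socle is characteristic in a normal subgroup, hence normal in `G`, and minimality
applies. This is how the decomposition L^I enters: the socle is generated by its own minimal normal
subgroups. -/
theorem SocleNonabelianMinimalNormal.socle_socle (h : SocleNonabelianMinimalNormal G) :
    socle (socle G) = ⊤ := by
  have : Nontrivial (socle G) := (Subgroup.nontrivial_iff_ne_bot _).mpr h.1.ne_bot
  obtain ⟨M, -, hM⟩ := exists_isMinimalNormal_le (X := (⊤ : Subgroup (socle G))) inferInstance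
    (by simp)
  have hb : (socle (socle G)).map (socle G).subtype ≠ ⊥ := by
    rw [Ne, Subgroup.map_eq_bot_iff_of_injective _ (socle G).subtype_injective]
    exact fun h0 => hM.ne_bot (le_bot_iff.mp (h0 ▸ hM.le_socle))
  have h1 := h.1.eq_of_le (X := (socle (socle G)).map (socle G).subtype)
    ConjAct.normal_of_characteristic_of_normal hb (Subgroup.map_subtype_le _)
  rw [eq_top_iff]
  intro x _
  have hx : (x : G) ∈ (socle (socle G)).map (socle G).subtype := h1.ge x.2
  obtain ⟨z, hz, hzx⟩ := hx
  exact (Subtype.ext hzx : z = x) ▸ hz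

theorem SocleNonabelianMinimalNormal.commute_ext (h : SocleNonabelianMinimalNormal G)
    {x : socle G} (hx : ∀ M : Subgroup (socle G), IsMinimalNormal M → ∀ y ∈ M, Commute x y) :
    x = 1 := by
  have h1 : socle (socle G) ≤ Subgroup.centralizer {x} :=
    sSup_le fun M hM y hy => Subgroup.mem_centralizer_singleton_iff.mpr (hx M hM y hy).symm
  rw [h.socle_socle] at h1
  refine Subtype.ext (h.eq_one_of_commute fun s hs => ?_)
  exact congrArg Subtype.val (Subgroup.mem_centralizer_singleton_iff.mp
    (h1 (Subgroup.mem_top (⟨s, hs⟩ : socle G))))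

/-- The minimal normal subgroups of the socle have trivial centres. -/
theorem SocleNonabelianMinimalNormal.eq_one_of_mem_factor (h : SocleNonabelianMinimalNormal G)
    {M : Subgroup (socle G)} (hM : IsMinimalNormal M) {x : socle G} (hx : x ∈ M)
    (hc : ∀ y ∈ M, Commute x y) : x = 1 := by
  refine h.commute_ext fun M' hM' y hy => ?_
  by_cases hMM : M = M'
  · subst hMM; exact hc y hy
  · exact hM.commute_of_ne hM' hMM hx hy

/-- The minimal normal subgroups of the socle are simple. -/
theorem SocleNonabelianMinimalNormal.factor_simple (h : SocleNonabelianMinimalNormal G)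
    {M : Subgroup (socle G)} (hM : IsMinimalNormal M) {R : Subgroup (socle G)} (hR : R ≤ M)
    (hn : ∀ x ∈ M, ∀ r ∈ R, x * r * x⁻¹ ∈ R) : R = ⊥ ∨ R = M := by
  by_cases hb : R = ⊥
  · exact Or.inl hb
  refine Or.inr (hM.eq_of_le ?_ hb hR)
  -- The other factors commute with `M`, so a subgroup normalized by `M` is normalized by the whole
  -- socle.
  have key : socle (socle G) ≤ Subgroup.normalizer (R : Set (socle G)) := by
    refine sSup_le fun M' hM' y hy => ?_
    have hsub : ∀ y ∈ M', ∀ r ∈ R, y * r * y⁻¹ ∈ R := by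
      intro y hy r hr
      by_cases hMM : M = M'
      · subst hMM; exact hn y hy r hr
      · have := hM.commute_of_ne hM' hMM (hR hr) hy
        rw [← this.eq]; simpa using hr
    rw [Subgroup.mem_normalizer_iff]
    intro r
    refine ⟨hsub y hy r, fun hr => ?_⟩
    have := hsub y⁻¹ (inv_mem hy) _ hr
    simpa [mul_assoc] using this
  rw [h.socle_socle] at key
  exact Subgroup.normalizer_eq_top_iff.mp (top_le_iff.mp key)

end Socle

/-! ### Families of commuting simple subgroups -/

/-- A family of pairwise commuting nonabelian simple subgroups. -/
structure IsFactorFamily {W T : Type*} [Group W] (F : T → Subgroup W) : Prop where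
  ne_bot : ∀ t, F t ≠ ⊥
  commute : ∀ s t, s ≠ t → ∀ x ∈ F s, ∀ y ∈ F t, Commute x y
  center : ∀ t, ∀ x ∈ F t, (∀ y ∈ F t, Commute x y) → x = 1
  simple : ∀ t (R : Subgroup W), R ≤ F t → (∀ x ∈ F t, ∀ r ∈ R, x * r * x⁻¹ ∈ R) →
    R = ⊥ ∨ R = F t

/-- Conjugation by `x` and by `f` have the same effect on `F`. -/
def ActsAs {W : Type*} [Group W] (F : Subgroup W) (x f : W) : Prop :=
  ∀ g ∈ F, x * g * x⁻¹ = f * g * f⁻¹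

section ActsAs

variable {W : Type*} [Group W] {F : Subgroup W} {x y f g : W}

theorem ActsAs.mul (hx : ActsAs F x f) (hy : ActsAs F y g) (hg : g ∈ F) :
    ActsAs F (x * y) (f * g) := by
  intro a ha
  have h1 := hy a ha
  have h2 := hx _ (mul_mem (mul_mem hg ha) (inv_mem hg))
  calc x * y * a * (x * y)⁻¹ = x * (y * a * y⁻¹) * x⁻¹ := by group
    _ = f * (g * a * g⁻¹) * f⁻¹ := by rw [h1, h2]
    _ = _ := by group

theorem ActsAs.inv (hx : ActsAs F x f) (hf : f ∈ F) : ActsAs F x⁻¹ f⁻¹ := by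
  intro a ha
  have h2 := hx _ (mul_mem (mul_mem (inv_mem hf) ha) hf)
  have h3 : a = x * (f⁻¹ * a * f) * x⁻¹ := by rw [h2]; group
  calc x⁻¹ * a * x⁻¹⁻¹ = x⁻¹ * (x * (f⁻¹ * a * f) * x⁻¹) * x⁻¹⁻¹ := by rw [← h3]
    _ = _ := by group

theorem ActsAs.refl (F : Subgroup W) (x : W) : ActsAs F x x := fun _ _ => rfl

theorem actsAs_one_iff : ActsAs F x 1 ↔ ∀ g ∈ F, Commute x g := by
  refine forall₂_congr fun g _ => ?_
  simp [commute_iff_eq, mul_inv_eq_iff_eq_mul]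

end ActsAs

namespace IsFactorFamily

variable {W T : Type*} [Group W] {F : T → Subgroup W} (hF : IsFactorFamily F)

include hF

/-- All factors except `F t` act trivially on `F t`. Together with `actsAs_unique` this gives the
projection onto `F t` without choosing a direct product decomposition. -/
theorem exists_actsAs (t : T) {x : W} (hx : x ∈ ⨆ s, F s) : ∃ f ∈ F t, ActsAs (F t) x f := by
  induction hx using Subgroup.iSup_induction' with
  | hp s x hx =>
    by_cases hst : s = t
    · subst hst; exact ⟨x, hx, .refl _ _⟩
    · exact ⟨1, one_mem _, actsAs_one_iff.mpr fun g hg => hF.commute s t hst x hx g hg⟩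
  | h1 => exact ⟨1, one_mem _, .refl _ _⟩
  | hmul x y _ _ ihx ihy =>
    obtain ⟨f, hf, hf'⟩ := ihx
    obtain ⟨g, hg, hg'⟩ := ihy
    exact ⟨f * g, mul_mem hf hg, hf'.mul hg' hg⟩

theorem actsAs_unique {t : T} {x f g : W} (hf : f ∈ F t) (hg : g ∈ F t)
    (h1 : ActsAs (F t) x f) (h2 : ActsAs (F t) x g) : f = g := by
  have h3 : ActsAs (F t) (f⁻¹ * g) 1 := by
    intro a ha
    have h4 := (h1 a ha).symm.trans (h2 a ha)
    calc f⁻¹ * g * a * (f⁻¹ * g)⁻¹ = f⁻¹ * (g * a * g⁻¹) * f := by group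
      _ = 1 * a * 1⁻¹ := by rw [← h4]; group
  have := hF.center t _ (mul_mem (inv_mem hf) hg) (actsAs_one_iff.mp h3)
  rwa [inv_mul_eq_one] at this

/-- An element of the product of all the factors that commutes with all factors outside `p` lies
in the product of the factors in `p`. -/
theorem mem_biSup_of_commute [Finite T] (p : Set T) {x : W} (hx : x ∈ ⨆ s, F s)
    (hc : ∀ t ∉ p, ∀ g ∈ F t, Commute x g) : x ∈ ⨆ s ∈ p, F s := by
  -- Factors outside `p` are removed one at a time; `q` is the set of those still present.
  have key : ∀ q : Set T, q.Finite → ∀ x ∈ ⨆ s ∈ p ∪ q, F s,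
      (∀ t ∉ p, ∀ g ∈ F t, Commute x g) → x ∈ ⨆ s ∈ p, F s := by
    intro q hq
    induction q, hq using Set.Finite.induction_on with
    | empty => intro x hx _; simpa using hx
    | @insert a q ha _ ih =>
      intro x hx hc
      by_cases hap : a ∈ p
      · refine ih x ?_ hc
        rwa [Set.union_insert, Set.insert_eq_of_mem (Set.mem_union_left _ hap)] at hx
      rw [Set.union_insert, iSup_insert] at hx
      have hnorm : ∀ y ∈ F a, ∀ z ∈ ⨆ s ∈ p ∪ q, F s, Commute y z := by
        intro y hy z hz
        have : (⨆ s ∈ p ∪ q, F s) ≤ Subgroup.centralizer {y} := by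
          refine iSup₂_le fun s hs w hw => Subgroup.mem_centralizer_singleton_iff.mpr ?_
          have hsa : s ≠ a := by
            rintro rfl
            exact hs.elim hap ha
          exact hF.commute s a hsa w hw y hy
        exact (Subgroup.mem_centralizer_singleton_iff.mp (this hz) : Commute z y).symm
      have hsup : F a ≤ Subgroup.normalizer ((⨆ s ∈ p ∪ q, F s : Subgroup W) : Set W) := by
        intro y hy
        rw [Subgroup.mem_normalizer_iff]
        intro z
        refine ⟨fun hz => ?_, fun hz => ?_⟩
        · rw [(hnorm y hy z hz).eq]; simpa using hz
        · have h1 := (hnorm y hy _ hz).eq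
          have h2 : y * z * y⁻¹ = z := by
            have : y * (y * z * y⁻¹) = y * z := by rw [h1]; group
            exact mul_left_cancel this
          rwa [h2] at hz
      rw [sup_comm] at hx
      have hx' : x ∈ ((((⨆ s ∈ p ∪ q, F s) ⊔ F a : Subgroup W)) : Set W) := hx
      rw [Subgroup.coe_mul_of_right_le_normalizer_left _ _ hsup] at hx'
      obtain ⟨z, hz, y, hy, rfl⟩ := Set.mem_mul.mp hx'
      -- Both z * y and z commute with `F a`, so y is central in `F a`.
      have hy1 : y = 1 := by
        refine hF.center a y hy fun g hg => ?_
        have h1 := hc a hap g hg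
        have h2 := (hnorm g hg z hz).symm
        have h3 := h2.inv_left.mul_left h1
        simpa using h3
      subst hy1
      rw [mul_one] at hc ⊢
      exact ih z hz hc
  refine key Set.univ Set.finite_univ x ?_ hc
  simpa using hx

variable {N : Subgroup W} (hN : N ≤ ⨆ s, F s) (hfull : ∀ t, ∀ f ∈ F t, ∃ x ∈ N, ActsAs (F t) x f)

include hN hfull

/-- The projection of `X` to `F t` is normalized by the projection of `N`, which is all of `F t`;
simplicity leaves two cases. -/
theorem full_or_trivial {X : Subgroup W} (hX : X ≤ N)
    (hXn : ∀ n ∈ N, ∀ x ∈ X, n * x * n⁻¹ ∈ X) (t : T) :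
    (∀ f ∈ F t, ∃ x ∈ X, ActsAs (F t) x f) ∨ ∀ x ∈ X, ∀ g ∈ F t, Commute x g := by
  let R : Subgroup W :=
    { carrier := {f | f ∈ F t ∧ ∃ x ∈ X, ActsAs (F t) x f}
      one_mem' := ⟨one_mem _, 1, one_mem _, .refl _ _⟩
      mul_mem' := by
        rintro f g ⟨hf, x, hx, hxf⟩ ⟨hg, y, hy, hyg⟩
        exact ⟨mul_mem hf hg, x * y, mul_mem hx hy, hxf.mul hyg hg⟩
      inv_mem' := by
        rintro f ⟨hf, x, hx, hxf⟩
        exact ⟨inv_mem hf, x⁻¹, inv_mem hx, hxf.inv hf⟩ }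
  rcases hF.simple t R (fun f hf => hf.1) (by
    rintro g hg f ⟨hf, x, hx, hxf⟩
    obtain ⟨n, hn, hng⟩ := hfull t g hg
    exact ⟨mul_mem (mul_mem hg hf) (inv_mem hg), n * x * n⁻¹, hXn n hn x hx,
      (hng.mul hxf hf).mul (hng.inv hg) (inv_mem hg)⟩) with h | h
  · right
    intro x hx
    obtain ⟨f, hf, hxf⟩ := hF.exists_actsAs t (hN (hX hx))
    have : f ∈ R := ⟨hf, x, hx, hxf⟩
    rw [h, Subgroup.mem_bot] at this
    subst this
    exact actsAs_one_iff.mp hxf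
  · left
    intro f hf
    rw [← h] at hf
    exact hf.2

omit hN hfull in
theorem not_commutative (t : T) : ∃ f ∈ F t, ∃ g ∈ F t, ¬ Commute f g := by
  by_contra! h
  exact hF.ne_bot t ((Subgroup.eq_bot_iff_forall _).mpr fun x hx => hF.center t x hx (h x hx))

omit hN hfull in
-- If the intersection acted trivially, commutators of `X` with `Y` would too; but these project to
-- all commutators of `F t`, which is not abelian.
theorem full_inf {X Y : Subgroup W} {t : T}
    (hX : ∀ f ∈ F t, ∃ x ∈ X, ActsAs (F t) x f) (hY : ∀ f ∈ F t, ∃ x ∈ Y, ActsAs (F t) x f)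
    (hXY : ∀ x ∈ X, ∀ y ∈ Y, x * y * x⁻¹ * y⁻¹ ∈ X ⊓ Y)
    (hor : (∀ f ∈ F t, ∃ x ∈ X ⊓ Y, ActsAs (F t) x f) ∨ ∀ x ∈ X ⊓ Y, ∀ g ∈ F t, Commute x g) :
    ∀ f ∈ F t, ∃ x ∈ X ⊓ Y, ActsAs (F t) x f := by
  rcases hor with h | h
  · exact h
  exfalso
  obtain ⟨f, hf, g, hg, hfg⟩ := hF.not_commutative t
  obtain ⟨x, hx, hxf⟩ := hX f hf
  obtain ⟨y, hy, hyg⟩ := hY g hg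
  have h1 := ((hxf.mul hyg hg).mul (hxf.inv hf) (inv_mem hf)).mul (hyg.inv hg) (inv_mem hg)
  have h2 := actsAs_one_iff.mpr (h _ (hXY x hx y hy))
  have h3 := hF.actsAs_unique
    (mul_mem (mul_mem (mul_mem hf hg) (inv_mem hf)) (inv_mem hg)) (one_mem _) h1 h2
  apply hfg
  rw [commute_iff_eq]
  calc f * g = (f * g * f⁻¹ * g⁻¹) * (g * f) := by group
    _ = g * f := by rw [h3, one_mul]

/-- The elements of `N` that centralize `F t`. -/
theorem full_of_ne {q t : T}
    (hne : N ⊓ Subgroup.centralizer (F q : Set W) ≠ N ⊓ Subgroup.centralizer (F t : Set W)) :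
    ∀ f ∈ F t, ∃ x ∈ N ⊓ Subgroup.centralizer (F q : Set W), ActsAs (F t) x f := by
  have hnorm : ∀ s, ∀ n ∈ N, ∀ x ∈ N ⊓ Subgroup.centralizer (F s : Set W),
      n * x * n⁻¹ ∈ N ⊓ Subgroup.centralizer (F s : Set W) := by
    intro s n hn x hx0
    obtain ⟨hx, hxc⟩ := Subgroup.mem_inf.mp hx0
    refine Subgroup.mem_inf.mpr ⟨mul_mem (mul_mem hn hx) (inv_mem hn), ?_⟩
    obtain ⟨f, hf, hnf⟩ := hF.exists_actsAs s (hN hn)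
    have hx1 : ActsAs (F s) x 1 :=
      actsAs_one_iff.mpr fun g hg => (Subgroup.mem_centralizer_iff.mp hxc g hg).symm
    have := (hnf.mul hx1 (one_mem _)).mul (hnf.inv hf) (inv_mem hf)
    rw [mul_one, mul_inv_cancel, actsAs_one_iff] at this
    exact Subgroup.mem_centralizer_iff.mpr fun g hg => (this g hg).symm
  rcases hF.full_or_trivial hN hfull inf_le_left (hnorm q) t with h | h
  · exact h
  exfalso
  have hle : N ⊓ Subgroup.centralizer (F q : Set W) ≤ N ⊓ Subgroup.centralizer (F t : Set W) :=
    fun x hx => ⟨hx.1, Subgroup.mem_centralizer_iff.mpr fun g hg => (h x hx g hg).symm⟩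
  -- In the first case N = C_N(F t)·C_N(F q), and both lie in C(F t), so N acts trivially on `F t`.
  -- In the second case the two centralizers coincide.
  rcases hF.full_or_trivial hN hfull inf_le_left (hnorm t) q with h' | h'
  · obtain ⟨f, hf, g, hg, hfg⟩ := hF.not_commutative t
    have hall : ∀ n ∈ N, n ∈ Subgroup.centralizer (F t : Set W) := by
      intro n hn
      obtain ⟨f, hf, hnf⟩ := hF.exists_actsAs q (hN hn)
      obtain ⟨x, hx, hxf⟩ := h' f hf
      have h1 := hnf.mul (hxf.inv hf) (inv_mem hf)
      rw [mul_inv_cancel, actsAs_one_iff] at h1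
      have h2 : n * x⁻¹ ∈ N ⊓ Subgroup.centralizer (F q : Set W) :=
        Subgroup.mem_inf.mpr ⟨mul_mem hn (inv_mem (Subgroup.mem_inf.mp hx).1),
          Subgroup.mem_centralizer_iff.mpr fun g hg => (h1 g hg).symm⟩
      have := mul_mem (Subgroup.mem_inf.mp (hle h2)).2 (Subgroup.mem_inf.mp hx).2
      simpa using this
    obtain ⟨n, hn, hnf⟩ := hfull t f hf
    have h1 : ActsAs (F t) n 1 := actsAs_one_iff.mpr fun g hg =>
      (Subgroup.mem_centralizer_iff.mp (hall n hn) g hg).symm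
    have : f = 1 := hF.actsAs_unique hf (one_mem _) hnf h1
    subst this
    exact hfg (Commute.one_left _)
  · exact hne (le_antisymm hle fun x hx =>
      ⟨hx.1, Subgroup.mem_centralizer_iff.mpr fun g hg => (h' x hx g hg).symm⟩)

/-- The elements of `N` in the product of the factors linked to `F t` induce all inner
automorphisms of `F t`. -/
theorem full_block [Finite T] (p : Set T) (t : T)
    (hp : ∀ q ∉ p, N ⊓ Subgroup.centralizer (F q : Set W) ≠
      N ⊓ Subgroup.centralizer (F t : Set W)) :
    ∀ f ∈ F t, ∃ x ∈ N ⊓ ⨆ s ∈ p, F s, ActsAs (F t) x f := by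
  have hnorm : ∀ Q : Set T, ∀ n ∈ N, ∀ x ∈ N ⊓ ⨅ q ∈ Q, Subgroup.centralizer (F q : Set W),
      n * x * n⁻¹ ∈ N ⊓ ⨅ q ∈ Q, Subgroup.centralizer (F q : Set W) := by
    intro Q n hn x hx0
    obtain ⟨hx, hxc⟩ := Subgroup.mem_inf.mp hx0
    refine Subgroup.mem_inf.mpr ⟨mul_mem (mul_mem hn hx) (inv_mem hn), ?_⟩
    simp only [Subgroup.mem_iInf] at hxc ⊢
    intro s hs
    obtain ⟨f, hf, hnf⟩ := hF.exists_actsAs s (hN hn)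
    have hx1 : ActsAs (F s) x 1 :=
      actsAs_one_iff.mpr fun g hg => (Subgroup.mem_centralizer_iff.mp (hxc s hs) g hg).symm
    have := (hnf.mul hx1 (one_mem _)).mul (hnf.inv hf) (inv_mem hf)
    rw [mul_one, mul_inv_cancel, actsAs_one_iff] at this
    exact Subgroup.mem_centralizer_iff.mpr fun g hg => (this g hg).symm
  -- Each single centralizer is full on `F t` by `full_of_ne`, and fullness survives finite
  -- intersections by `full_inf`. Centralizing every factor outside `p` then means lying in the
  -- product over `p`.
  have key : ∀ Q : Set T, Q.Finite → Q ⊆ pᶜ →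
      ∀ f ∈ F t, ∃ x ∈ N ⊓ ⨅ q ∈ Q, Subgroup.centralizer (F q : Set W), ActsAs (F t) x f := by
    intro Q hQ
    induction Q, hQ using Set.Finite.induction_on with
    | empty =>
      intro _ f hf
      simpa using hfull t f hf
    | @insert a Q ha _ ih =>
      intro hsub
      have h1 := ih ((Set.subset_insert _ _).trans hsub)
      have h2 := hF.full_of_ne hN hfull (hp a (hsub (Set.mem_insert _ _)))
      have heq : (N ⊓ Subgroup.centralizer (F a : Set W)) ⊓
          (N ⊓ ⨅ q ∈ Q, Subgroup.centralizer (F q : Set W)) =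
          N ⊓ ⨅ q ∈ insert a Q, Subgroup.centralizer (F q : Set W) := by
        rw [iInf_insert, ← inf_inf_distrib_left]
      have hn1 := hnorm {a}
      simp only [Set.mem_singleton_iff, iInf_iInf_eq_left] at hn1
      rw [← heq]
      refine hF.full_inf h2 h1 ?_ ?_
      · intro x hx y hy
        refine Subgroup.mem_inf.mpr ⟨?_, ?_⟩
        · rw [mul_assoc, mul_assoc, ← mul_assoc y]
          exact mul_mem hx (hn1 y (Subgroup.mem_inf.mp hy).1 _ (inv_mem hx))
        · exact mul_mem (hnorm Q x (Subgroup.mem_inf.mp hx).1 y hy) (inv_mem hy)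
      · rw [heq]
        exact hF.full_or_trivial hN hfull inf_le_left (hnorm _) t
  intro f hf
  obtain ⟨x, hx, hxf⟩ := key pᶜ (Set.toFinite _) subset_rfl f hf
  refine ⟨x, ⟨hx.1, hF.mem_biSup_of_commute p (hN hx.1) fun s hs g hg => ?_⟩, hxf⟩
  have := (Subgroup.mem_inf.mp hx).2
  simp only [Subgroup.mem_iInf] at this
  exact (Subgroup.mem_centralizer_iff.mp (this s hs) g hg).symm

end IsFactorFamily

/-! ### The simple factors of a product of socles -/

section Product

variable {J : Type*} (U : J → Type*) [∀ j, Group (U j)]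

open Classical in
/-- The embedding of the socle of one factor into the product. -/
def socleSingle (j : J) : socle (U j) →* ∀ j, U j :=
  (MonoidHom.mulSingle U j).comp (socle (U j)).subtype

open Classical in
theorem socleSingle_apply (j : J) (x : socle (U j)) :
    socleSingle U j x = Pi.mulSingle j (x : U j) := rfl

@[simp]
theorem socleSingle_same (j : J) (x : socle (U j)) : socleSingle U j x j = x := by
  classical
  simp [socleSingle_apply]

theorem socleSingle_of_ne {i j : J} (h : i ≠ j) (x : socle (U j)) : socleSingle U j x i = 1 := by
  classical
  simp [socleSingle_apply, Pi.mulSingle_eq_of_ne h]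

theorem socleSingle_injective (j : J) : Function.Injective (socleSingle U j) := fun x y h =>
  Subtype.ext (by rw [← socleSingle_same U j x, h, socleSingle_same])

theorem factor_eq (s : FactorIndex U) : factor U s = s.2.1.map (socleSingle U s.1) := by
  rw [factor, Subgroup.map_map]; rfl

theorem mem_factor {s : FactorIndex U} {x : ∀ j, U j} :
    x ∈ factor U s ↔ ∃ y ∈ s.2.1, socleSingle U s.1 y = x := by
  rw [factor_eq]; rfl

/-- Conjugation of an element of the image of `socleSingle`. -/
theorem commute_socleSingle_iff {j : J} {x : ∀ j, U j} {y : socle (U j)} :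
    Commute x (socleSingle U j y) ↔ Commute (x j) y := by
  refine ⟨fun h => ?_, fun h => funext fun i => ?_⟩
  · simpa [commute_iff_eq] using congrFun h j
  · by_cases hij : i = j
    · subst hij; simpa using h.eq
    · simp [socleSingle_of_ne U hij]

variable [∀ j, Finite (U j)] (hU : ∀ j, SocleNonabelianMinimalNormal (U j))

include hU

theorem isFactorFamily_factor : IsFactorFamily (factor U) where
  ne_bot s := by
    rw [factor_eq, Ne, Subgroup.map_eq_bot_iff_of_injective _ (socleSingle_injective U s.1)]
    exact s.2.2.ne_bot
  commute s t hst x hx y hy := by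
    obtain ⟨a, ha, rfl⟩ := (mem_factor U).mp hx
    obtain ⟨b, hb, rfl⟩ := (mem_factor U).mp hy
    rw [commute_socleSingle_iff]
    obtain ⟨i, S⟩ := s
    obtain ⟨j, S'⟩ := t
    by_cases hij : i = j
    · subst hij
      have hne : S.1 ≠ S'.1 := fun h => hst (by rw [Subtype.ext h])
      have := S.2.commute_of_ne S'.2 hne ha hb
      rw [socleSingle_same]
      exact congrArg Subtype.val this
    · simp [socleSingle_of_ne U (Ne.symm hij)]
  center s x hx hc := by
    obtain ⟨a, ha, rfl⟩ := (mem_factor U).mp hx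
    have : a = 1 := (hU s.1).eq_one_of_mem_factor s.2.2 ha fun y hy => by
      have := hc _ ((mem_factor U).mpr ⟨y, hy, rfl⟩)
      rw [commute_socleSingle_iff, socleSingle_same] at this
      exact Subtype.ext this
    rw [this, map_one]
  simple s R hR hn := by
    have hle : R.comap (socleSingle U s.1) ≤ s.2.1 := by
      intro a ha
      obtain ⟨b, hb, hab⟩ := (mem_factor U).mp (hR ha)
      exact socleSingle_injective U _ hab ▸ hb
    have hR' : (R.comap (socleSingle U s.1)).map (socleSingle U s.1) = R := by
      refine Subgroup.map_comap_eq_self fun x hx => ?_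
      obtain ⟨b, -, hb⟩ := (mem_factor U).mp (hR hx)
      exact ⟨b, hb⟩
    rcases (hU s.1).factor_simple s.2.2 hle (fun x hx r hr => by
      have := hn _ ((mem_factor U).mpr ⟨x, hx, rfl⟩) _ hr
      rwa [← map_inv, ← map_mul, ← map_mul] at this) with h | h
    · left; rw [← hR', h, Subgroup.map_bot]
    · right; rw [← hR', h, factor_eq]

/-- The nontrivial inclusion rests on `socle_socle`: each socle is generated by its simple factors.
-/
theorem iSup_factor [Finite J] : ⨆ s, factor U s = soclePower U := by
  classical
  apply le_antisymm
  · refine iSup_le fun s x hx => ?_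
    obtain ⟨a, ha, rfl⟩ := (mem_factor U).mp hx
    intro i _
    by_cases h : i = s.1
    · subst h; simp
    · simp [socleSingle_of_ne U h]
  · rw [soclePower, Subgroup.pi_le_iff]
    rintro j x ⟨a, ha, rfl⟩
    have h1 : socle (socle (U j)) ≤ (⨆ s, factor U s).comap (socleSingle U j) := by
      refine sSup_le fun M hM y hy => ?_
      exact Subgroup.mem_iSup_of_mem (⟨j, ⟨M, hM⟩⟩ : FactorIndex U)
        ((mem_factor U).mpr ⟨y, hy, rfl⟩)
    rw [(hU j).socle_socle] at h1
    have := h1 (Subgroup.mem_top ⟨a, ha⟩)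
    rw [Subgroup.mem_comap, socleSingle_apply] at this
    convert! this

/-- An element of the socle is determined by its action on the simple factors. -/
theorem eq_one_of_commute_factor {x : ∀ j, U j} {j : J} (hx : x j ∈ socle (U j))
    (hc : ∀ S : SimpleFactor (U j), ∀ g ∈ factor U ⟨j, S⟩, Commute x g) : x j = 1 := by
  have : (⟨x j, hx⟩ : socle (U j)) = 1 := (hU j).commute_ext fun M hM y hy => by
    have := hc ⟨M, hM⟩ _ ((mem_factor U).mpr ⟨y, hy, rfl⟩)
    rw [commute_socleSingle_iff] at this
    exact Subtype.ext this
  exact congrArg Subtype.val this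

omit hU in
instance [Finite J] : Finite (FactorIndex U) :=
  have (j : J) : Finite (SimpleFactor (U j)) := Subtype.finite
  inferInstanceAs (Finite (Σ j, SimpleFactor (U j)))

omit [∀ j, Finite (U j)] hU in
/-- The relation on the simple factors given by equality of their centralizers in `N`. -/
def centralizerSetoid (N : Subgroup (∀ j, U j)) : Setoid (FactorIndex U) :=
  Setoid.ker fun s => N ⊓ Subgroup.centralizer (factor U s : Set (∀ j, U j))

variable [Finite J] {K : Subgroup (∀ j, U j)}

omit [∀ j, Finite (U j)] hU [Finite J] in
-- Conjugation on a factor over coordinate j depends only on the j-th coordinate of the conjugating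
-- element.
theorem full_of_surjective {N : Subgroup (∀ j, U j)}
    (hsurj : ∀ j, ∀ x ∈ socle (U j), ∃ n ∈ N, n j = x) (s : FactorIndex U) :
    ∀ f ∈ factor U s, ∃ x ∈ N, ActsAs (factor U s) x f := by
  intro f hf
  obtain ⟨a, ha, rfl⟩ := (mem_factor U).mp hf
  obtain ⟨n, hn, hna⟩ := hsurj s.1 a a.2
  refine ⟨n, hn, fun g hg => ?_⟩
  obtain ⟨b, hb, rfl⟩ := (mem_factor U).mp hg
  funext i
  by_cases h : i = s.1
  · subst h; simp [hna]
  · simp [socleSingle_of_ne U h]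

/-- If the socle of `K` lies in the product of the socles and projects onto each of them, then the
relation `centralizerSetoid` is the partition of the simple factors attached to `K`. -/
theorem isSoclePartition_centralizerSetoid (hle : (socle K).map K.subtype ≤ soclePower U)
    (hsurj : ∀ j, ∀ x ∈ socle (U j), ∃ n ∈ (socle K).map K.subtype, n j = x) :
    IsSoclePartition U K (centralizerSetoid U (K ⊓ soclePower U)) := by
  have hF := isFactorFamily_factor U hU
  set N := K ⊓ soclePower U with hNdef
  set S := (socle K).map K.subtype with hSdef
  have hSN : S ≤ N := le_inf (Subgroup.map_subtype_le _) hle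
  have hN : N ≤ ⨆ s, factor U s := inf_le_right.trans (iSup_factor U hU).ge
  have hSfull := full_of_surjective U hsurj
  have hfull : ∀ s, ∀ f ∈ factor U s, ∃ x ∈ N, ActsAs (factor U s) x f := fun s f hf => by
    obtain ⟨x, hx, h⟩ := hSfull s f hf
    exact ⟨x, hSN hx, h⟩
  have hpow : ∀ p, factorPower U p ≤ soclePower U := fun p =>
    (iSup₂_le fun s _ => le_iSup (factor U) s).trans (iSup_factor U hU).le
  have hKN : ∀ p, K ⊓ factorPower U p = N ⊓ factorPower U p := fun p =>
    le_antisymm (le_inf (le_inf inf_le_left (inf_le_right.trans (hpow p))) inf_le_right)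
      (inf_le_inf_right _ inf_le_left)
  -- the blocks
  have hclass : ∀ p ∈ (centralizerSetoid U N).classes, ∀ s ∈ p, ∀ q, q ∈ p ↔
      N ⊓ Subgroup.centralizer (factor U q : Set (∀ j, U j)) =
      N ⊓ Subgroup.centralizer (factor U s : Set (∀ j, U j)) := by
    rintro p ⟨t, rfl⟩ s hs q
    have hs' : N ⊓ Subgroup.centralizer (factor U s : Set (∀ j, U j)) =
      N ⊓ Subgroup.centralizer (factor U t : Set (∀ j, U j)) := hs
    rw [hs']
    rfl
  have hblock : ∀ p ∈ (centralizerSetoid U N).classes, ∀ s ∈ p, ∀ f ∈ factor U s,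
      ∃ x ∈ N ⊓ factorPower U p, ActsAs (factor U s) x f := fun p hp s hs =>
    hF.full_block hN hfull p s fun q hq h => hq ((hclass p hp s hs q).mpr h)
  -- an element of a block is determined by its action on any factor in it
  have hinj : ∀ p ∈ (centralizerSetoid U N).classes, ∀ s ∈ p, ∀ x ∈ N ⊓ factorPower U p,
      (∀ g ∈ factor U s, Commute x g) → x = 1 := by
    intro p hp s hs x hx hc
    obtain ⟨hxN, hxp⟩ := Subgroup.mem_inf.mp hx
    have hcs : x ∈ N ⊓ Subgroup.centralizer (factor U s : Set (∀ j, U j)) :=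
      Subgroup.mem_inf.mpr
        ⟨hxN, Subgroup.mem_centralizer_iff.mpr fun g hg => (hc g hg).symm⟩
    have := hF.mem_biSup_of_commute ∅ (hN hxN) (fun t _ g hg => ?_)
    · simpa using this
    by_cases ht : t ∈ p
    · rw [← (hclass p hp s hs t).mp ht] at hcs
      exact (Subgroup.mem_centralizer_iff.mp (Subgroup.mem_inf.mp hcs).2 g hg).symm
    · have : factorPower U p ≤ Subgroup.centralizer {g} := by
        refine iSup₂_le fun r hr y hy => Subgroup.mem_centralizer_singleton_iff.mpr ?_
        exact hF.commute r t (fun h => ht (h ▸ hr)) y hy g hg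
      exact Subgroup.mem_centralizer_singleton_iff.mp (this hxp)
  have hprod : ⨆ p ∈ (centralizerSetoid U N).classes, K ⊓ factorPower U p = N := by
    simp_rw [hKN]
    apply le_antisymm
    · exact iSup₂_le fun p _ => inf_le_left
    set D := ⨆ p ∈ (centralizerSetoid U N).classes, N ⊓ factorPower U p with hD
    have hDN : D ≤ N := iSup₂_le fun p _ => inf_le_left
    -- An element of `N` is corrected by elements of `D` until it centralizes all factors, hence is
    -- trivial. For a new factor `a`, the element y of its block with the same action on `a` is
    -- divided out. The result centralizes the whole block, as linked factors have equal
    -- centralizers in `N`, and factors outside the block do not notice y.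
    have key : ∀ Q : Set (FactorIndex U), Q.Finite → ∀ x ∈ N, ∃ d ∈ D,
        ∀ s ∈ Q, ∀ g ∈ factor U s, Commute (d * x) g := by
      intro Q hQ
      induction Q, hQ using Set.Finite.induction_on with
      | empty => exact fun x _ => ⟨1, one_mem _, by simp⟩
      | @insert a Q _ _ ih =>
        intro x hx
        obtain ⟨d, hd, hdQ⟩ := ih x hx
        have hdx : d * x ∈ N := mul_mem (hDN hd) hx
        obtain ⟨f, hf, hdf⟩ := hF.exists_actsAs a (hN hdx)
        set p := {t | (centralizerSetoid U N) t a} with hp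
        have hpc : p ∈ (centralizerSetoid U N).classes := ⟨a, rfl⟩
        have hap : a ∈ p := (centralizerSetoid U N).refl a
        obtain ⟨y, hy, hyf⟩ := hblock p hpc a hap f hf
        have hone : ∀ g ∈ factor U a, Commute (y⁻¹ * (d * x)) g := by
          have := (hyf.inv hf).mul hdf hf
          rwa [inv_mul_cancel, actsAs_one_iff] at this
        refine ⟨y⁻¹ * d, mul_mem (inv_mem ?_) hd, ?_⟩
        · exact Subgroup.mem_iSup_of_mem p (Subgroup.mem_iSup_of_mem hpc hy)
        intro s hs g hg
        rw [mul_assoc]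
        by_cases hsp : s ∈ p
        · have h1 : y⁻¹ * (d * x) ∈ N ⊓ Subgroup.centralizer (factor U a : Set (∀ j, U j)) :=
            Subgroup.mem_inf.mpr ⟨mul_mem (inv_mem (Subgroup.mem_inf.mp hy).1) hdx,
              Subgroup.mem_centralizer_iff.mpr fun g hg => (hone g hg).symm⟩
          rw [← (hclass p hpc a hap s).mp hsp] at h1
          exact (Subgroup.mem_centralizer_iff.mp (Subgroup.mem_inf.mp h1).2 g hg).symm
        · have hsQ : s ∈ Q := hs.resolve_left fun h => hsp (h ▸ hap)
          have h1 : factorPower U p ≤ Subgroup.centralizer {g} := by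
            refine iSup₂_le fun r hr y hy => Subgroup.mem_centralizer_singleton_iff.mpr ?_
            exact hF.commute r s (fun h => hsp (h ▸ hr)) y hy g hg
          have h2 : Commute y g :=
            Subgroup.mem_centralizer_singleton_iff.mp (h1 (Subgroup.mem_inf.mp hy).2)
          exact h2.inv_left.mul_left (hdQ s hsQ g hg)
    intro x hx
    obtain ⟨d, hd, hdx⟩ := key Set.univ Set.finite_univ x hx
    have h1 : d * x = 1 := by
      have := hF.mem_biSup_of_commute ∅ (hN (mul_mem (hDN hd) hx))
        (fun t _ g hg => hdx t trivial g hg)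
      simpa using this
    rw [← inv_eq_of_mul_eq_one_right h1]
    exact inv_mem hd
  refine ⟨fun p hp s hs => ?_, ?_, hprod⟩
  · rw [hKN]
    -- The isomorphism is the projection to the single factor `s`: injective by `hinj`, surjective
    -- by `hblock`.
    have hx := fun x : ↥(N ⊓ factorPower U p) =>
      hF.exists_actsAs s (hN (Subgroup.mem_inf.mp x.2).1)
    choose φ hφ hφa using hx
    let Φ : ↥(N ⊓ factorPower U p) →* ↥(factor U s) :=
      MonoidHom.mk' (fun x => ⟨φ x, hφ x⟩) fun x y => Subtype.ext
        (hF.actsAs_unique (hφ _) (mul_mem (hφ x) (hφ y)) (hφa _) ((hφa x).mul (hφa y) (hφ y)))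
    have hΦi : Function.Injective Φ := by
      rw [injective_iff_map_eq_one]
      intro x hx
      have h1 : φ x = 1 := congrArg Subtype.val hx
      have h2 := hφa x
      rw [h1, actsAs_one_iff] at h2
      exact Subtype.ext (hinj p hp s hs x x.2 h2)
    have hΦs : Function.Surjective Φ := by
      rintro ⟨f, hf⟩
      obtain ⟨x, hx, hxf⟩ := hblock p hp s hs f hf
      exact ⟨⟨x, hx⟩, Subtype.ext (hF.actsAs_unique (hφ _) hf (hφa _) hxf)⟩
    have e : ↥s.2.1 ≃* ↥(factor U s) :=
      (s.2.1.equivMapOfInjective _ (socleSingle_injective U s.1)).trans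
        (MulEquiv.subgroupCongr (factor_eq U s).symm)
    exact ⟨(MulEquiv.ofBijective Φ ⟨hΦi, hΦs⟩).trans e.symm⟩
  · refine le_antisymm hSN ?_
    refine hprod.ge.trans ?_
    refine iSup₂_le fun p hp => ?_
    rw [hKN]
    obtain ⟨a, rfl⟩ := hp
    set p := {t | (centralizerSetoid U N) t a} with hp
    have hpc : p ∈ (centralizerSetoid U N).classes := ⟨a, rfl⟩
    have hap : a ∈ p := (centralizerSetoid U N).refl a
    have hnormN : ∀ k ∈ N, ∀ x ∈ N ⊓ factorPower U p, k * x * k⁻¹ ∈ N ⊓ factorPower U p := by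
      intro k hk x hx
      obtain ⟨hxN, hxp⟩ := Subgroup.mem_inf.mp hx
      refine Subgroup.mem_inf.mpr ⟨mul_mem (mul_mem hk hxN) (inv_mem hk), ?_⟩
      refine hF.mem_biSup_of_commute p (hN (mul_mem (mul_mem hk hxN) (inv_mem hk))) ?_
      intro t ht
      obtain ⟨f, hf, hkf⟩ := hF.exists_actsAs t (hN hk)
      have hx1 : ActsAs (factor U t) x 1 := by
        refine actsAs_one_iff.mpr fun g hg => ?_
        have : factorPower U p ≤ Subgroup.centralizer {g} := by
          refine iSup₂_le fun r hr y hy => Subgroup.mem_centralizer_singleton_iff.mpr ?_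
          exact hF.commute r t (fun h => ht (h ▸ hr)) y hy g hg
        exact Subgroup.mem_centralizer_singleton_iff.mp (this hxp)
      have := (hkf.mul hx1 (one_mem _)).mul (hkf.inv hf) (inv_mem hf)
      rwa [mul_one, mul_inv_cancel, actsAs_one_iff] at this
    have hSnorm : ∀ k ∈ K, ∀ x ∈ S, k * x * k⁻¹ ∈ S := by
      rintro k hk _ ⟨x, hx, rfl⟩
      exact ⟨_, (inferInstance : (socle K).Normal).conj_mem x hx ⟨k, hk⟩, rfl⟩
    have hinf : N ⊓ factorPower U p ≤ N := inf_le_left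
    -- The socle and the block both project onto the factor `a`, so by commutators their
    -- intersection does. Since the block injects into that factor, it lies in the socle.
    have hXfull : ∀ f ∈ factor U a, ∃ x ∈ S ⊓ (N ⊓ factorPower U p), ActsAs (factor U a) x f := by
      have hXn : ∀ n ∈ N, ∀ x ∈ S ⊓ (N ⊓ factorPower U p),
          n * x * n⁻¹ ∈ S ⊓ (N ⊓ factorPower U p) := fun n hn x hx =>
        ⟨hSnorm n (Subgroup.mem_inf.mp hn).1 x (Subgroup.mem_inf.mp hx).1,
          hnormN n hn x (Subgroup.mem_inf.mp hx).2⟩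
      refine hF.full_inf (hSfull a) (hblock p hpc a hap) ?_
        (hF.full_or_trivial hN hfull (inf_le_right.trans hinf) hXn a)
      intro x hx y hy
      refine Subgroup.mem_inf.mpr ⟨?_, ?_⟩
      · rw [mul_assoc, mul_assoc, ← mul_assoc y]
        exact mul_mem hx (hSnorm y (Subgroup.mem_inf.mp (hinf hy)).1 _ (inv_mem hx))
      · exact mul_mem (hnormN x (hSN hx) y hy) (inv_mem hy)
    intro x hx
    obtain ⟨f, hf, hxf⟩ := hF.exists_actsAs a (hN (hinf hx))
    obtain ⟨y, hy, hyf⟩ := hXfull f hf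
    obtain ⟨hyS, hyp⟩ := Subgroup.mem_inf.mp hy
    have h1 := (hyf.inv hf).mul hxf hf
    rw [inv_mul_cancel, actsAs_one_iff] at h1
    have h2 := hinj p hpc a hap _ (mul_mem (inv_mem hyp) hx) h1
    rw [inv_mul_eq_one] at h2
    exact h2 ▸ hyS

end Product

/-! ### Large kernels -/

section Large

variable {Γ J : Type*} [Group Γ] {U : J → Type*} [∀ j, Group (U j)]
  (b : Γ →* Equiv.Perm J) (c : Γ →* MulAut (∀ j, U j))

/-- The group `Γ` acts on `∏ U j` compatibly with its action on `J`. -/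
def PermutesFactors : Prop :=
  ∀ γ w j, c γ w (b γ j) = 1 ↔ w j = 1

variable {b c}

/-- Applying the condition to w * w'⁻¹ shows that coordinate b γ j of c γ w depends only on
coordinate j of w. -/
theorem PermutesFactors.congr (h : PermutesFactors b c) {γ : Γ} {w w' : ∀ j, U j} {j : J}
    (hw : w j = w' j) : c γ w (b γ j) = c γ w' (b γ j) := by
  have := (h γ (w * w'⁻¹) j).mpr (by simp [hw])
  rw [map_mul, map_inv, Pi.mul_apply, Pi.inv_apply, mul_inv_eq_one] at this
  exact this

/-- Factors in the same orbit are isomorphic. -/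
theorem PermutesFactors.exists_mulEquiv (h : PermutesFactors b c) (γ : Γ) (j : J) :
    Nonempty (U j ≃* U (b γ j)) := by
  classical
  refine ⟨MulEquiv.ofBijective (((Pi.evalMonoidHom U (b γ j)).comp (c γ).toMonoidHom).comp
    (MonoidHom.mulSingle U j)) ⟨?_, fun v => ?_⟩⟩
  · rw [injective_iff_map_eq_one]
    intro x hx
    have := (h γ (Pi.mulSingle j x) j).mp hx
    simpa using this
  · refine ⟨(c γ).symm (Pi.mulSingle (b γ j) v) j, ?_⟩
    have := h.congr (γ := γ) (w := Pi.mulSingle j ((c γ).symm (Pi.mulSingle (b γ j) v) j))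
      (w' := (c γ).symm (Pi.mulSingle (b γ j) v)) (j := j) (by simp)
    refine this.trans ?_
    rw [MulEquiv.apply_symm_apply]
    simp

/-- A nontrivial invariant subgroup projects onto a subgroup containing the socle. -/
theorem PermutesFactors.exists_apply_eq [∀ j, Finite (U j)] (h : PermutesFactors b c)
    (htrans : ∀ i j, ∃ γ, b γ i = j)
    (hinn : ∀ j (u : U j), ∃ γ, b γ j = j ∧ ∀ w, c γ w j = u * w j * u⁻¹)
    (hU : ∀ j, SocleNonabelianMinimalNormal (U j)) {X : Subgroup (∀ j, U j)}
    (hX : ∀ γ, ∀ w ∈ X, c γ w ∈ X) (hb : X ≠ ⊥) (j : J) :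
    ∀ x ∈ socle (U j), ∃ n ∈ X, n j = x := by
  have hn : (X.map (Pi.evalMonoidHom U j)).Normal := by
    constructor
    rintro _ ⟨w, hw, rfl⟩ u
    obtain ⟨γ, -, hγ⟩ := hinn j u
    exact ⟨c γ w, hX γ w hw, hγ w⟩
  refine fun x hx => (hU j).socle_le hn (fun h0 => hb ?_) hx
  rw [Subgroup.eq_bot_iff_forall] at h0 ⊢
  refine fun w hw => funext fun i => ?_
  obtain ⟨γ, rfl⟩ := htrans j i
  have h1 := h γ (c γ⁻¹ w) j
  rw [← MulAut.mul_apply, ← map_mul, mul_inv_cancel, map_one, MulAut.one_apply] at h1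
  exact h1.mpr (h0 _ ⟨_, hX γ⁻¹ w hw, rfl⟩)

/-- The socle of `K` lies in the product of the socles if `K` projects onto groups containing
the socles. -/
theorem map_socle_le_soclePower [Finite J] [∀ j, Finite (U j)]
    (hU : ∀ j, SocleNonabelianMinimalNormal (U j)) {K : Subgroup (∀ j, U j)}
    (hK : ∀ j, ∀ x ∈ socle (U j), ∃ n ∈ K, n j = x) :
    (socle K).map K.subtype ≤ soclePower U := by
  rw [Subgroup.map_le_iff_le_comap]
  refine sSup_le fun M (hM : IsMinimalNormal M) x hx j _ => ?_
  set S : Subgroup K := (socle (U j)).comap ((Pi.evalMonoidHom U j).comp K.subtype) with hS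
  change x ∈ S
  have hMn := hM.normal
  have hSn : S.Normal := inferInstance
  have h1 := hM.eq_of_le (X := M ⊓ S) inferInstance
  -- Either `M` lies in `S`, or it commutes with `S`. In the latter case the coordinate of x
  -- centralizes the socle, because `S` projects onto it, and is therefore trivial.
  by_cases hb : M ⊓ S = ⊥
  swap
  · rw [← h1 hb inf_le_left] at hx
    exact hx.2
  have hcomm : ∀ m ∈ M, ∀ s ∈ S, Commute m s := fun m hm s hs =>
    Subgroup.commute_of_normal_of_disjoint M S hMn hSn (disjoint_iff.mpr hb) m s hm hs
  have : (x : ∀ j, U j) j = 1 := (hU j).eq_one_of_commute fun s hs => by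
    obtain ⟨n, hn, rfl⟩ := hK j s hs
    exact congrFun (congrArg Subtype.val (hcomm x hx ⟨n, hn⟩ hs)).symm j
  change (x : ∀ j, U j) j ∈ socle (U j)
  rw [this]
  exact one_mem _

/-- Each `c γ` restricts to an automorphism of `K`, and automorphisms preserve the socle. -/
theorem map_socle_invariant {K : Subgroup (∀ j, U j)} (hK : ∀ γ, ∀ w ∈ K, c γ w ∈ K) (γ : Γ) :
    ∀ w ∈ (socle K).map K.subtype, c γ w ∈ (socle K).map K.subtype := by
  have hmap : K.map (c γ).toMonoidHom = K := by
    apply le_antisymm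
    · rintro _ ⟨w, hw, rfl⟩
      exact hK γ w hw
    · intro w hw
      refine ⟨c γ⁻¹ w, hK _ w hw, ?_⟩
      change c γ (c γ⁻¹ w) = w
      rw [← MulAut.mul_apply, ← map_mul, mul_inv_cancel, map_one, MulAut.one_apply]
  let e : K ≃* K := ((c γ).subgroupMap K).trans (MulEquiv.subgroupCongr hmap)
  rintro _ ⟨w, hw, rfl⟩
  exact ⟨e w, map_socle_le e ⟨w, hw, rfl⟩, rfl⟩

/-- If no two coordinates of the elements of `K ⊓ soclePower U` are equivalent, the conjugation
compatible subgroup `K` is large. -/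
theorem isLarge_of_forall_ne [Finite J] [∀ j, Finite (U j)]
    (hU : ∀ j, SocleNonabelianMinimalNormal (U j)) {K : Subgroup (∀ j, U j)}
    (hle : (socle K).map K.subtype ≤ soclePower U)
    (hsurj : ∀ j, ∀ x ∈ socle (U j), ∃ n ∈ (socle K).map K.subtype, n j = x)
    (hcc : IsConjCompatible U K)
    (hne : ∀ i j, i ≠ j → ¬ ∀ n ∈ (socle K).map K.subtype, n i = 1 ↔ n j = 1) : IsLarge U K := by
  have hF := isFactorFamily_factor U hU
  have hP := isSoclePartition_centralizerSetoid U hU hle hsurj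
  have hpart := hcc _ hP
  have hSN := hP.socle_eq
  set N := K ⊓ soclePower U with hN
  rw [hSN] at hsurj hne
  have hNle : N ≤ ⨆ s, factor U s := inf_le_right.trans (iSup_factor U hU).ge
  have hNsoc : ∀ n ∈ N, ∀ j, n j ∈ socle (U j) := fun n hn j =>
    (Subgroup.mem_inf.mp hn).2 j trivial
  have hfull := full_of_surjective U hsurj
  -- equivalent factors over the same coordinate are equal
  have hone : ∀ s t, centralizerSetoid U N s t → s.1 = t.1 → s = t := by
    intro s t hst h1
    by_contra hne'
    have hst' : N ⊓ Subgroup.centralizer (factor U s : Set (∀ j, U j)) =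
      N ⊓ Subgroup.centralizer (factor U t : Set (∀ j, U j)) := hst
    obtain ⟨f, hf, g, hg, hfg⟩ := hF.not_commutative s
    obtain ⟨y, hy, rfl⟩ := (mem_factor U).mp hf
    -- An n whose coordinate over s is a noncentral element of that factor centralizes every other
    -- factor over the same coordinate, but not `s`.
    obtain ⟨n, hn, hny⟩ := hsurj s.1 y y.2
    have hnt : n ∈ N ⊓ Subgroup.centralizer (factor U t : Set (∀ j, U j)) := by
      refine Subgroup.mem_inf.mpr ⟨hn, Subgroup.mem_centralizer_iff.mpr fun h hh => ?_⟩
      have h2 := hF.commute s t hne' _ hf h hh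
      obtain ⟨z, hz, rfl⟩ := (mem_factor U).mp hh
      rw [commute_socleSingle_iff] at h2
      refine ((commute_socleSingle_iff U).mpr ?_).symm
      obtain ⟨j, S⟩ := s
      obtain ⟨j', S'⟩ := t
      obtain rfl : j = j' := h1
      rwa [socleSingle_same, ← hny] at h2
    rw [← hst'] at hnt
    have h3 : Commute n g :=
      (Subgroup.mem_centralizer_iff.mp (Subgroup.mem_inf.mp hnt).2 g hg).symm
    obtain ⟨z, hz, rfl⟩ := (mem_factor U).mp hg
    rw [commute_socleSingle_iff, hny] at h3
    apply hfg
    rw [commute_socleSingle_iff, socleSingle_same]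
    exact h3
  -- triviality of a coordinate is detected by the factors over it
  have hdetect : ∀ n ∈ N, ∀ j, (∀ S : SimpleFactor (U j),
      n ∈ N ⊓ Subgroup.centralizer (factor U ⟨j, S⟩ : Set (∀ j, U j))) ↔ n j = 1 := by
    intro n hn j
    refine ⟨fun h => eq_one_of_commute_factor U hU (hNsoc n hn j) fun S g hg =>
      (Subgroup.mem_centralizer_iff.mp (Subgroup.mem_inf.mp (h S)).2 g hg).symm, fun h S => ?_⟩
    refine Subgroup.mem_inf.mpr ⟨hn, Subgroup.mem_centralizer_iff.mpr fun g hg => ?_⟩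
    obtain ⟨y, hy, rfl⟩ := (mem_factor U).mp hg
    exact ((commute_socleSingle_iff U).mpr (by simp [h])).symm
  -- equivalent factors lie over the same coordinate
  have hsame : ∀ s t, centralizerSetoid U N s t → s.1 = t.1 := by
    intro s t hst
    by_contra hne'
    have hq : ∀ r : FactorIndex U, Sigma.fst '' {x | centralizerSetoid U N x r} ∈
        {q : Set J | ∃ p ∈ (centralizerSetoid U N).classes, q = Sigma.fst '' p} :=
      fun r => ⟨_, ⟨r, rfl⟩, rfl⟩
    have hmem : ∀ r : FactorIndex U, r.1 ∈ Sigma.fst '' {x | centralizerSetoid U N x r} :=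
      fun r => ⟨r, (centralizerSetoid U N).refl r, rfl⟩
    -- Let i and j lie in the image of the block of t. The block of any factor S over j has an image
    -- containing j; images are disjoint or equal, so this image contains i, and S is linked to some
    -- factor R over i. Hence triviality at i forces triviality at j.
    have hdir : ∀ i j, i ∈ Sigma.fst '' {x | centralizerSetoid U N x t} →
        j ∈ Sigma.fst '' {x | centralizerSetoid U N x t} → ∀ n ∈ N, n i = 1 → n j = 1 := by
      intro i j hi hj n hn hni
      rw [← hdetect n hn] at hni ⊢
      intro S
      have heq := (hpart.2 j).unique ⟨hq ⟨j, S⟩, hmem ⟨j, S⟩⟩ ⟨hq t, hj⟩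
      rw [← heq] at hi
      obtain ⟨⟨i', R⟩, hR, rfl⟩ := hi
      have hR' : N ⊓ Subgroup.centralizer (factor U ⟨i', R⟩ : Set (∀ j, U j)) =
        N ⊓ Subgroup.centralizer (factor U ⟨j, S⟩ : Set (∀ j, U j)) := hR
      exact hR' ▸ hni R
    exact hne s.1 t.1 hne' fun n hn => ⟨hdir _ _ ⟨s, hst, rfl⟩ (hmem t) n hn,
      hdir _ _ (hmem t) ⟨s, hst, rfl⟩ n hn⟩
  rw [IsLarge, ← iSup_factor U hU]
  refine iSup_le fun s f hf => ?_
  -- All blocks are now singletons, so `N` meets each factor in the full factor.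
  obtain ⟨x, hx, hxf⟩ := hF.full_block hNle hfull {s} s
    (fun q hq h => hq (hone q s h (hsame q s h))) f hf
  obtain ⟨hxN, hxs⟩ := Subgroup.mem_inf.mp hx
  simp only [Set.mem_singleton_iff, iSup_iSup_eq_left] at hxs
  have := hF.actsAs_unique hxs hf (.refl _ _) hxf
  exact this ▸ (Subgroup.mem_inf.mp hxN).1

/-- A homomorphism to the automorphism group of a quotient. -/
theorem exists_hom_mulAut {H N S : Type*} [Group H] [Group N] [Group S] (q : N →* S)
    (hq : Function.Surjective q) (ψ : H →* MulAut N) (hψ : ∀ h n, q n = 1 → q (ψ h n) = 1) :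
    ∃ φ : H →* MulAut S, ∀ h n, φ h (q n) = q (ψ h n) := by
  have hcongr : ∀ h n n', q n = q n' → q (ψ h n) = q (ψ h n') := by
    intro h n n' hn
    have := hψ h (n * n'⁻¹) (by simp [hn])
    rwa [map_mul, map_inv, map_mul, map_inv, mul_inv_eq_one] at this
  choose r hr using hq
  let f (h : H) : S →* S := MonoidHom.mk' (fun s => q (ψ h (r s))) fun s t => by
    rw [← map_mul, ← map_mul]
    exact hcongr h _ _ (by rw [map_mul, hr, hr, hr])
  have hf : ∀ h n, f h (q n) = q (ψ h n) := fun h n => hcongr h _ _ (hr _)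
  have hff : ∀ g h s, f g (f h s) = f (g * h) s := by
    intro g h s
    obtain ⟨n, rfl⟩ : ∃ n, q n = s := ⟨r s, hr s⟩
    rw [hf, hf, hf, map_mul, MulAut.mul_apply]
  have hf1 : ∀ s, f 1 s = s := by
    intro s
    obtain ⟨n, rfl⟩ : ∃ n, q n = s := ⟨r s, hr s⟩
    rw [hf, map_one, MulAut.one_apply]
  let φ : H →* MulAut S := MonoidHom.mk' (fun h =>
    { toFun := f h
      invFun := f h⁻¹
      left_inv := fun s => by rw [hff, inv_mul_cancel, hf1]
      right_inv := fun s => by rw [hff, mul_inv_cancel, hf1]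
      map_mul' := map_mul (f h) }) fun g h => MulEquiv.ext fun s => (hff g h s).symm
  exact ⟨φ, hf⟩

/-- Two coordinates of the elements of an invariant subgroup `N` that projects onto the socles
are not equivalent. -/
theorem not_coordinates_equivalent [∀ j, Finite (U j)] {A : Type*} {a : Γ →* Equiv.Perm A}
    {π : A → J} (hπ : ∀ γ x, π (a γ x) = b γ (π x)) (htrans : ∀ x y, ∃ γ, a γ x = y)
    (htransJ : ∀ i j, ∃ γ, b γ i = j) (hperm : PermutesFactors b c) {α : A} {j₀ : J} (hα : π α = j₀)
    (hstab : ∀ γ, b γ j₀ = j₀ → ∃ u : U j₀, (∀ w, c γ w j₀ = u * w j₀ * u⁻¹) ∧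
      (u = 1 ↔ ∀ x, π x = j₀ → a γ x = x))
    (hU : SocleNonabelianMinimalNormal (U j₀))
    (hinv : ∀ H : Subgroup Γ, (∀ γ, a γ α = α → γ ∈ H) → (∃ γ ∈ H, a γ α ≠ α) →
      ∃ γ ∈ H, b γ j₀ = j₀ ∧ a γ α ≠ α)
    (hemb : ∀ H : Subgroup Γ, (∀ γ, b γ j₀ = j₀ → γ ∈ H) → (∃ γ ∈ H, b γ j₀ ≠ j₀) →
      ∀ φ : H →* MulAut (socle (U j₀)),
        ¬ ∀ γ : H, φ γ = 1 ↔ ∀ δ ∈ H, a γ (a δ α) = a δ α)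
    {N : Subgroup (∀ j, U j)} (hN : ∀ γ, ∀ w ∈ N, c γ w ∈ N) (hle : N ≤ soclePower U)
    (hsurj : ∀ x ∈ socle (U j₀), ∃ n ∈ N, n j₀ = x) {j₁ : J} (hne : j₁ ≠ j₀) :
    ¬ ∀ n ∈ N, n j₁ = 1 ↔ n j₀ = 1 := by
  intro heq
  have hNiff : ∀ γ w, c γ w ∈ N ↔ w ∈ N := fun γ w => by
    refine ⟨fun h => ?_, hN γ w⟩
    have := hN γ⁻¹ _ h
    rwa [← MulAut.mul_apply, ← map_mul, inv_mul_cancel, map_one, MulAut.one_apply] at this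
  -- `H` preserves the kernel of `N` → U j₀, so it acts on the quotient, which is the socle of U j₀.
  let H : Subgroup Γ :=
    { carrier := {γ | ∀ n ∈ N, c γ n j₀ = 1 ↔ n j₀ = 1}
      one_mem' := fun n _ => by rw [map_one, MulAut.one_apply]
      mul_mem' := fun {γ δ} hγ hδ n hn => by
        rw [map_mul, MulAut.mul_apply, hγ _ (hN δ n hn), hδ n hn]
      inv_mem' := fun {γ} hγ n hn => by
        rw [← hγ _ (hN γ⁻¹ n hn), ← MulAut.mul_apply, ← map_mul, mul_inv_cancel, map_one,
          MulAut.one_apply] }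
  have hstabH : ∀ γ, b γ j₀ = j₀ → γ ∈ H := fun γ hγ n _ => by
    have := hperm γ n j₀
    rwa [hγ] at this
  have hfix : ∀ γ, a γ α = α → b γ j₀ = j₀ := fun γ hγ => by
    rw [← hα, ← hπ, hγ]
  have hH : ∃ γ ∈ H, b γ j₀ ≠ j₀ := by
    -- An element carrying j₀ to j₁ preserves the kernel because both coordinates have the same
    -- kernel on `N`.
    obtain ⟨γ, hγ'⟩ := htransJ j₀ j₁
    refine ⟨γ, fun n hn => ?_, hγ' ▸ hne⟩
    rw [← heq _ (hN γ n hn), ← hγ']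
    exact hperm γ n j₀
  -- the action on the socle
  let ψ : H →* MulAut N := MonoidHom.mk' (fun γ =>
    { toFun := fun n => ⟨c γ n, hN γ n n.2⟩
      invFun := fun n => ⟨c (γ⁻¹ : Γ) n, hN _ n n.2⟩
      left_inv := fun n => Subtype.ext (by
        change c (γ⁻¹ : Γ) (c γ n) = n
        rw [← MulAut.mul_apply, ← map_mul, inv_mul_cancel, map_one, MulAut.one_apply])
      right_inv := fun n => Subtype.ext (by
        change c γ (c (γ⁻¹ : Γ) n) = n
        rw [← MulAut.mul_apply, ← map_mul, mul_inv_cancel, map_one, MulAut.one_apply])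
      map_mul' := fun m n => Subtype.ext (map_mul (c γ) (m : ∀ j, U j) n) })
    fun γ δ => MulEquiv.ext fun n => Subtype.ext (by
      change c (γ * δ : Γ) n = c γ (c δ n)
      rw [map_mul, MulAut.mul_apply])
  let q : N →* socle (U j₀) := ((Pi.evalMonoidHom U j₀).comp N.subtype).codRestrict _
    fun n => hle n.2 j₀ trivial
  have hq : Function.Surjective q := by
    rintro ⟨x, hx⟩
    obtain ⟨n, hn, rfl⟩ := hsurj x hx
    exact ⟨⟨n, hn⟩, rfl⟩
  obtain ⟨φ, hφ⟩ := exists_hom_mulAut q hq ψ fun γ n hn =>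
    Subtype.ext ((γ.2 n n.2).mpr (congrArg Subtype.val hn))
  have hφ1 : ∀ γ : H, φ γ = 1 ↔ ∀ n ∈ N, c γ n j₀ = n j₀ := by
    intro γ
    refine ⟨fun h n hn => ?_, fun h => MulEquiv.ext fun s => ?_⟩
    · have := hφ γ ⟨n, hn⟩
      rw [h, MulAut.one_apply] at this
      exact (congrArg Subtype.val this).symm
    · obtain ⟨n, rfl⟩ := hq s
      rw [hφ, MulAut.one_apply]
      exact Subtype.ext (h n n.2)
  have hfib : ∀ x, π x = j₀ → ∃ δ, b δ j₀ = j₀ ∧ a δ α = x := by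
    intro x hx
    obtain ⟨δ, hδ⟩ := htrans α x
    exact ⟨δ, by rw [← hα, ← hπ, hδ, hx, hα], hδ⟩
  have hback : ∀ γ : H, (∀ δ ∈ H, a γ (a δ α) = a δ α) → φ γ = 1 := by
    intro γ hγ
    have h1 : ∀ x, π x = j₀ → a γ x = x := by
      intro x hx
      obtain ⟨δ, hδ, rfl⟩ := hfib x hx
      exact hγ δ (hstabH δ hδ)
    have h2 : b γ j₀ = j₀ := hfix γ (h1 α hα)
    obtain ⟨u, hu, hu1⟩ := hstab γ h2
    rw [hφ1]
    intro n _
    rw [hu, hu1.mpr h1]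
    simp
  -- If ker φ fixed α, normality would make it fix the whole `H`-orbit of α. Then φ would have
  -- exactly the kernel of the action on that orbit, against `hemb`.
  have hmove : ∃ γ : H, φ γ = 1 ∧ a γ α ≠ α := by
    by_contra! hcon
    refine hemb H hstabH hH φ fun γ => ⟨fun hγ δ hδ => ?_, hback γ⟩
    have h1 := hcon ((⟨δ, hδ⟩ : H)⁻¹ * γ * ⟨δ, hδ⟩) (by simp [hγ])
    have h2 := congrArg (a δ) h1
    simpa [← Equiv.Perm.mul_apply, ← map_mul, mul_assoc] using h2
  let S : Subgroup H :=
    { carrier := {γ | a γ α = α}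
      one_mem' := by simp
      mul_mem' := fun {γ δ} (hγ : a γ α = α) (hδ : a δ α = α) => by
        simp [hγ, hδ]
      inv_mem' := fun {γ} (hγ : a γ α = α) => by
        change a (γ : Γ)⁻¹ α = α
        rw [map_inv, Equiv.Perm.inv_eq_iff_eq]
        exact hγ.symm }
  -- The preimage under φ of φ(S) is the group S · ker φ, strictly larger than the stabilizer of α.
  obtain ⟨γ, hγ, hγj, hγα⟩ := hinv (((S.map φ).comap φ).map H.subtype) (fun γ hγ =>
    ⟨⟨γ, hstabH γ (hfix γ hγ)⟩, ⟨⟨γ, hstabH γ (hfix γ hγ)⟩, hγ, rfl⟩, rfl⟩) (by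
      obtain ⟨γ, hγ, hγα⟩ := hmove
      exact ⟨γ, ⟨γ, ⟨1, one_mem _, by rw [hγ, map_one]⟩, rfl⟩, hγα⟩)
  obtain ⟨γ, ⟨δ, hδ, hδγ⟩, rfl⟩ := hγ
  have hδα : a δ α = α := hδ
  set η : H := δ⁻¹ * γ with hη
  have hη1 : φ η = 1 := by rw [hη, map_mul, map_inv, hδγ, inv_mul_cancel]
  have hηj : b η j₀ = j₀ := by
    have : b γ j₀ = j₀ := hγj
    rw [hη, Subgroup.coe_mul, map_mul, Equiv.Perm.mul_apply, this, Subgroup.coe_inv, map_inv,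
      Equiv.Perm.inv_eq_iff_eq]
    exact (hfix δ hδα).symm
  obtain ⟨u, hu, hu1⟩ := hstab η hηj
  -- η acts trivially on the socle and preserves block j₀, so its permutation of the block
  -- centralizes the socle. Hence η fixes α, and so does γ = δη.
  have : u = 1 := hU.eq_one_of_commute fun s hs => by
    obtain ⟨n, hn, rfl⟩ := hsurj s hs
    have h1 := (hφ1 η).mp hη1 n hn
    rw [hu, mul_inv_eq_iff_eq_mul] at h1
    exact h1.symm
  have h2 := hu1.mp this α hα
  apply hγα
  have h3 := congrArg (a δ) h2
  rw [hδα, ← Equiv.Perm.mul_apply, ← map_mul] at h3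
  simpa [hη] using h3

end Large

/-! ### Imprimitive permutation groups -/

section Blocks

variable {J A : Type*} {B : J → Type*} (e : (Σ j, B j) ≃ A) (U : ∀ j, Subgroup (Equiv.Perm (B j)))

@[simp]
theorem blockHom_apply (w : ∀ j, U j) (j : J) (β : B j) :
    blockHom e U w (e ⟨j, β⟩) = e ⟨j, (w j).1 β⟩ := by
  simp [blockHom, Equiv.permCongrHom, Equiv.Perm.sigmaCongrRightHom]

theorem blockHom_injective : Function.Injective (blockHom e U) := by
  intro v w h
  funext j
  refine Subtype.ext (Equiv.ext fun β => ?_)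
  have := congrArg (fun σ => σ (e ⟨j, β⟩)) h
  simpa using this

theorem blockHom_ext {w : ∀ j, U j} {σ : Equiv.Perm A}
    (h : ∀ j β, σ (e ⟨j, β⟩) = e ⟨j, (w j).1 β⟩) : blockHom e U w = σ := by
  refine Equiv.ext fun x => ?_
  obtain ⟨⟨j, β⟩, rfl⟩ := e.surjective x
  rw [h, blockHom_apply]

theorem apply_eq_one_iff_blockHom {w : ∀ j, U j} {j : J} :
    w j = 1 ↔ ∀ x, (e.symm x).1 = j → blockHom e U w x = x := by
  constructor
  · intro h x hx
    obtain ⟨⟨i, β⟩, rfl⟩ := e.surjective x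
    obtain rfl : i = j := by simpa using hx
    simp [h]
  · intro h
    refine Subtype.ext (Equiv.ext fun β => ?_)
    have := h (e ⟨j, β⟩) (by simp)
    simpa using this

/-- If a group acts on a set with a block system so that the group induced on each block by its
stabilizer is `U j`, and if its action satisfies the conditions that correspond to invariance and
Galois-properness, then the conjugation compatible kernel of the action on the blocks is large. -/
theorem isLarge_of_blocks {Γ : Type*} [Group Γ] [Finite J] [Finite A]
    (a : Γ →* Equiv.Perm A) (b : Γ →* Equiv.Perm J)
    (hab : ∀ γ x, (e.symm (a γ x)).1 = b γ (e.symm x).1)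
    (htrans : ∀ x y, ∃ γ, a γ x = y) (htransJ : ∀ i j, ∃ γ, b γ i = j)
    (hstab : ∀ j γ, b γ j = j → ∃ u : U j, ∀ β, a γ (e ⟨j, β⟩) = e ⟨j, u.1 β⟩)
    (hreal : ∀ j (u : U j), ∃ γ, b γ j = j ∧ ∀ β, a γ (e ⟨j, β⟩) = e ⟨j, u.1 β⟩)
    (K : Subgroup (∀ j, U j)) (hK : ∀ w, w ∈ K ↔ ∃ γ, b γ = 1 ∧ a γ = blockHom e U w)
    (j₀ : J) (α : A) (hα : (e.symm α).1 = j₀)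
    (hinv : ∀ H : Subgroup Γ, (∀ γ, a γ α = α → γ ∈ H) → (∃ γ ∈ H, a γ α ≠ α) →
      ∃ γ ∈ H, b γ j₀ = j₀ ∧ a γ α ≠ α)
    (hU : SocleNonabelianMinimalNormal (U j₀)) (hcc : IsConjCompatible (fun j => U j) K)
    (hker : (∃ j, j ≠ j₀) → ∃ γ, b γ = 1 ∧ a γ ≠ 1)
    (hemb : ∀ H : Subgroup Γ, (∀ γ, b γ j₀ = j₀ → γ ∈ H) → (∃ γ ∈ H, b γ j₀ ≠ j₀) →
      ∀ φ : H →* MulAut (socle (U j₀)),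
        ¬ ∀ γ : H, φ γ = 1 ↔ ∀ δ ∈ H, a γ (a δ α) = a δ α) :
    IsLarge (fun j => U j) K := by
  have hinj := blockHom_injective e U
  -- With a single block the kernel is everything, by `hreal`; nontriviality of the kernel is only
  -- available when there are at least two blocks.
  by_cases hJ : ∃ j, j ≠ j₀
  swap
  · push Not at hJ
    intro w _
    obtain ⟨γ, -, hγ⟩ := hreal j₀ (w j₀)
    refine (hK w).mpr ⟨γ, Equiv.ext fun j => ?_, (blockHom_ext e U fun j β => ?_).symm⟩
    · rw [hJ j, hJ (b γ j₀), Equiv.Perm.one_apply]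
    · obtain rfl := hJ j
      exact hγ β
  have hBfin : ∀ j, Finite (B j) := fun j =>
    Finite.of_injective (fun β => e ⟨j, β⟩) fun β β' h => by simpa using h
  have hUfin : ∀ j, Finite (U j) := fun j => inferInstance
  -- the conjugation action on the product
  have hconj : ∀ γ (w : ∀ j, U j), ∃ v, blockHom e U v = a γ * blockHom e U w * (a γ)⁻¹ := by
    intro γ w
    have hv : ∀ j, ∃ u : U j, ∀ β, (a γ * blockHom e U w * (a γ)⁻¹) (e ⟨j, β⟩) =
        e ⟨j, u.1 β⟩ := by
      intro j
      -- On block j the conjugate by γ agrees with γδγ⁻¹, where δ realizes the coordinate of w at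
      -- γ⁻¹j. This element stabilizes j, so it induces an element of `U j`.
      obtain ⟨δ, hδ, hδw⟩ := hreal (b γ⁻¹ j) (w (b γ⁻¹ j))
      have h1 : b (γ * δ * γ⁻¹) j = j := by
        rw [map_mul, map_mul, Equiv.Perm.mul_apply, Equiv.Perm.mul_apply, hδ,
          ← Equiv.Perm.mul_apply, ← map_mul]
        simp
      obtain ⟨u, hu⟩ := hstab j _ h1
      refine ⟨u, fun β => ?_⟩
      rw [← hu, map_mul, map_mul, Equiv.Perm.mul_apply, Equiv.Perm.mul_apply, Equiv.Perm.mul_apply,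
        Equiv.Perm.mul_apply, ← map_inv]
      congr 1
      have h2 : (e.symm (a γ⁻¹ (e ⟨j, β⟩))).1 = b γ⁻¹ j := by rw [hab]; simp
      obtain ⟨⟨i, β'⟩, hi⟩ := e.surjective (a γ⁻¹ (e ⟨j, β⟩))
      rw [← hi] at h2 ⊢
      simp only [Equiv.symm_apply_apply] at h2
      subst h2
      rw [blockHom_apply, hδw]
    choose v hv using hv
    exact ⟨v, blockHom_ext e U hv⟩
  choose f hf using hconj
  let c : Γ →* MulAut (∀ j, U j) := MonoidHom.mk' (fun γ =>
    { toFun := f γ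
      invFun := f γ⁻¹
      left_inv := fun w => hinj (by rw [hf, hf, map_inv]; group)
      right_inv := fun w => hinj (by rw [hf, hf, map_inv]; group)
      map_mul' := fun v w => hinj (by rw [map_mul, hf, hf, hf, map_mul]; group) })
    fun γ δ => MulEquiv.ext fun w => hinj (by
      change blockHom e U (f (γ * δ) w) = blockHom e U (f γ (f δ w))
      rw [hf, hf, hf, map_mul]; group)
  have hc : ∀ γ w, blockHom e U (c γ w) = a γ * blockHom e U w * (a γ)⁻¹ := hf
  have hperm : PermutesFactors (U := fun j => U j) b c := by
    intro γ w j
    rw [apply_eq_one_iff_blockHom e U, apply_eq_one_iff_blockHom e U]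
    constructor
    · intro h x hx
      have := h (a γ x) (by rw [hab, hx])
      simpa [hc] using this
    · intro h x hx
      have := h ((a γ)⁻¹ x) (by
        rw [← map_inv, hab, hx, ← Equiv.Perm.mul_apply, ← map_mul]
        simp)
      rw [hc, Equiv.Perm.mul_apply, Equiv.Perm.mul_apply, this]
      simp
  have hcj : ∀ γ j (u : U j), (∀ β, a γ (e ⟨j, β⟩) = e ⟨j, u.1 β⟩) →
      ∀ w, c γ w j = u * w j * u⁻¹ := by
    intro γ j u hu w
    refine Subtype.ext (Equiv.ext fun β => ?_)
    obtain ⟨β, rfl⟩ := u.1.surjective β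
    have h1 : blockHom e U (c γ w) (e ⟨j, u.1 β⟩) = e ⟨j, u.1 ((w j).1 β)⟩ := by
      rw [hc, ← hu, Equiv.Perm.mul_apply, Equiv.Perm.mul_apply, Equiv.Perm.inv_def,
        Equiv.symm_apply_apply,
        blockHom_apply, hu]
    rw [blockHom_apply] at h1
    simpa using h1
  have hinn : ∀ j (u : U j), ∃ γ, b γ j = j ∧ ∀ w, c γ w j = u * w j * u⁻¹ := fun j u => by
    obtain ⟨γ, hγ, hu⟩ := hreal j u
    exact ⟨γ, hγ, hcj γ j u hu⟩
  have hKinv : ∀ γ, ∀ w ∈ K, c γ w ∈ K := by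
    intro γ w hw
    obtain ⟨δ, hδ, hδw⟩ := (hK w).mp hw
    refine (hK _).mpr ⟨γ * δ * γ⁻¹, by simp [hδ], ?_⟩
    rw [hc, ← hδw, map_mul, map_mul, map_inv]
  have hKne : K ≠ ⊥ := by
    obtain ⟨γ, hγ, hne⟩ := hker hJ
    have := fun j => hstab j γ (by rw [hγ, Equiv.Perm.one_apply])
    choose w hw using this
    intro h0
    have hwK : w ∈ K := (hK w).mpr ⟨γ, hγ, (blockHom_ext e U hw).symm⟩
    rw [h0, Subgroup.mem_bot] at hwK
    apply hne
    rw [← blockHom_ext e U hw, hwK, map_one]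
  have hUall : ∀ j, SocleNonabelianMinimalNormal (U j) := by
    intro j
    obtain ⟨γ, rfl⟩ := htransJ j₀ j
    obtain ⟨E⟩ := hperm.exists_mulEquiv γ j₀
    exact hU.map_equiv E
  have hle := map_socle_le_soclePower hUall (hperm.exists_apply_eq htransJ hinn hUall hKinv hKne)
  have hSinv := map_socle_invariant hKinv
  have hSne : (socle K).map K.subtype ≠ ⊥ := by
    rw [Ne, Subgroup.map_eq_bot_iff_of_injective _ K.subtype_injective]
    have : Nontrivial K := (Subgroup.nontrivial_iff_ne_bot K).mpr hKne
    obtain ⟨M, -, hM⟩ := exists_isMinimalNormal_le (X := (⊤ : Subgroup K)) inferInstance (by simp)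
    exact fun h0 => hM.ne_bot (le_bot_iff.mp (h0 ▸ hM.le_socle))
  have hsurj := hperm.exists_apply_eq htransJ hinn hUall hSinv hSne
  have hbase : ∀ j, j ≠ j₀ → ¬ ∀ n ∈ (socle K).map K.subtype, n j = 1 ↔ n j₀ = 1 := by
    intro j hj
    refine not_coordinates_equivalent (π := fun x => (e.symm x).1) hab htrans htransJ hperm hα ?_
      hU hinv hemb hSinv hle (hsurj j₀) hj
    intro γ hγ
    obtain ⟨u, hu⟩ := hstab j₀ γ hγ
    refine ⟨u, hcj γ j₀ u hu, ?_, fun h => Subtype.ext (Equiv.ext fun β => ?_)⟩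
    · rintro rfl x hx
      obtain ⟨⟨j, β⟩, rfl⟩ := e.surjective x
      obtain rfl : j = j₀ := by simpa using hx
      simpa using hu β
    · have := h (e ⟨j₀, β⟩) (by simp)
      rw [hu] at this
      simpa using this
  -- By transitivity an equivalence between any two coordinates is carried to one involving j₀.
  refine isLarge_of_forall_ne hUall hle hsurj hcc fun i j hij h => ?_
  obtain ⟨γ, hγ⟩ := htransJ i j₀
  refine hbase (b γ j) (fun h0 => hij ((b γ).injective (hγ.trans h0.symm))) fun n hn => ?_
  have h1 := h (c γ⁻¹ n) (hSinv _ n hn)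
  have h2 := hperm γ (c γ⁻¹ n)
  rw [← MulAut.mul_apply, ← map_mul, mul_inv_cancel, map_one, MulAut.one_apply] at h2
  rw [h2 j, ← h1, ← h2 i, hγ]

end Blocks

/-! ### Galois theory for embeddings into an algebraic closure -/

section Galois

variable {F L Ω : Type*} [Field F] [Field L] [Field Ω]

theorem charZero_of_ringHom [CharZero F] (i : F →+* L) : CharZero L :=
  charZero_of_injective_ringHom i.injective

/-- An algebraically closed algebraic extension of a field of characteristic zero is Galois. -/
theorem isGalois_of_isIntegral [CharZero F] [IsAlgClosed Ω] [Algebra F Ω]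
    (h : (algebraMap F Ω).IsIntegral) : IsGalois F Ω := by
  have : Algebra.IsIntegral F Ω := ⟨h⟩
  have : Algebra.IsAlgebraic F Ω := inferInstance
  have : IsAlgClosure F Ω := ⟨inferInstance, inferInstance⟩
  have : Normal F Ω := IsAlgClosure.normal F Ω
  exact ⟨⟩

/-- An automorphism fixing a field elementwise, as an algebra automorphism. -/
def galGroupEquiv [Algebra F Ω] : galGroup (algebraMap F Ω) ≃* Gal(Ω/F) where
  toFun σ := AlgEquiv.ofRingEquiv (f := σ.1) σ.2
  invFun σ := ⟨σ.toRingEquiv, σ.commutes⟩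
  left_inv _ := rfl
  right_inv _ := rfl
  map_mul' _ _ := rfl

variable [CharZero F] [IsAlgClosed Ω] (i : F →+* L)

/-- The subfield of `L` of elements whose images are fixed by `H`. -/
def fixedSubfield (α : L →+* Ω) (H : Subgroup (RingAut Ω)) : Subfield L where
  carrier := {l | ∀ σ ∈ H, σ (α l) = α l}
  one_mem' σ _ := by simp
  zero_mem' σ _ := by simp
  add_mem' ha hb σ hσ := by rw [map_add, map_add, ha σ hσ, hb σ hσ]
  mul_mem' ha hb σ hσ := by rw [map_mul, map_mul, ha σ hσ, hb σ hσ]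
  neg_mem' ha σ hσ := by rw [map_neg, map_neg, ha σ hσ]
  inv_mem' a ha σ hσ := by rw [map_inv₀, map_inv₀, ha σ hσ]

/-- The Galois correspondence for groups containing the automorphisms over `L`. -/
theorem galGroup_fixedSubfield (hi : i.Finite) (α : L →+* Ω) (hα : (α.comp i).IsIntegral)
    {H : Subgroup (RingAut Ω)} (h1 : galGroup α ≤ H) (h2 : H ≤ galGroup (α.comp i)) :
    galGroup (α.comp (fixedSubfield α H).subtype) = H := by
  algebraize [i, α, α.comp i]
  have hgal : IsGalois F Ω := isGalois_of_isIntegral hα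
  have : FiniteDimensional F L := hi
  let φ : L →ₐ[F] Ω := IsScalarTower.toAlgHom F L Ω
  have hφ : ∀ l, φ l = α l := fun l => rfl
  let H' : Subgroup Gal(Ω/F) := (H.subgroupOf (galGroup (algebraMap F Ω))).map
    (galGroupEquiv (F := F) (Ω := Ω)).toMonoidHom
  have hH' : ∀ σ : Gal(Ω/F), σ ∈ H' ↔ σ.toRingEquiv ∈ H := by
    intro σ
    constructor
    · rintro ⟨τ, hτ, rfl⟩
      exact hτ
    · intro h
      exact ⟨⟨σ.toRingEquiv, σ.commutes⟩, h, rfl⟩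
  have hfin : FiniteDimensional F φ.fieldRange :=
    inferInstanceAs (FiniteDimensional F φ.toLinearMap.range)
  -- `H'` contains the open group fixing the finite extension α(L), so it is open, hence closed, and
  -- the infinite Galois correspondence applies.
  have hle : φ.fieldRange.fixingSubgroup ≤ H' := by
    intro σ hσ
    rw [hH']
    refine h1 fun l => ?_
    rw [IntermediateField.mem_fixingSubgroup_iff] at hσ
    exact hσ (φ l) ⟨l, rfl⟩
  have hopen : IsOpen (H' : Set Gal(Ω/F)) :=
    Subgroup.isOpen_mono hle (IntermediateField.fixingSubgroup_isOpen φ.fieldRange)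
  have hclosed : IsClosed (H' : Set Gal(Ω/F)) := Subgroup.isClosed_of_isOpen H' hopen
  have hcorr := InfiniteGalois.fixingSubgroup_fixedField (⟨H', hclosed⟩ : ClosedSubgroup Gal(Ω/F))
  apply le_antisymm
  · intro σ hσ
    have hσF : ∀ a, σ (algebraMap F Ω a) = algebraMap F Ω a := by
      intro a
      exact hσ ⟨i a, fun τ hτ => h2 hτ a⟩
    let σ' : Gal(Ω/F) := galGroupEquiv ⟨σ, hσF⟩
    suffices σ' ∈ H' from (hH' σ').mp this
    change σ' ∈ ((⟨H', hclosed⟩ : ClosedSubgroup Gal(Ω/F)) : Subgroup Gal(Ω/F))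
    rw [← hcorr, IntermediateField.mem_fixingSubgroup_iff]
    intro z hz
    -- As `H'` contains the automorphisms over α(L), its fixed field lies in α(L), so nothing is
    -- lost by recording only the fixed elements of `L`.
    have hz1 : z ∈ φ.fieldRange := by
      rw [← InfiniteGalois.fixedField_fixingSubgroup φ.fieldRange]
      rw [IntermediateField.mem_fixedField_iff] at hz ⊢
      exact fun τ hτ => hz τ (hle hτ)
    obtain ⟨l, rfl⟩ := hz1
    refine hσ ⟨l, fun τ hτ => ?_⟩
    rw [IntermediateField.mem_fixedField_iff] at hz
    exact hz (galGroupEquiv ⟨τ, h2 hτ⟩) ((hH' _).mpr hτ)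
  · exact fun σ hσ l => l.2 σ hσ

omit [CharZero F] [IsAlgClosed Ω] in
theorem fieldRange_le_fixedSubfield (α : L →+* Ω) {H : Subgroup (RingAut Ω)}
    (h2 : H ≤ galGroup (α.comp i)) : i.fieldRange ≤ fixedSubfield α H := by
  rintro _ ⟨a, rfl⟩ σ hσ
  exact h2 hσ a

/-- Proper subfields are moved by some automorphism. -/
theorem exists_mem_galGroup_ne (α : L →+* Ω) (hα : (α.comp i).IsIntegral) {M : Subfield L}
    (hM : i.fieldRange ≤ M) {l : L} (hl : l ∉ M) :
    ∃ σ ∈ galGroup (α.comp M.subtype), σ (α l) ≠ α l := by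
  let : Algebra M Ω := (α.comp M.subtype).toAlgebra
  have : CharZero M := charZero_of_ringHom (i.codRestrict M fun a => hM ⟨a, rfl⟩)
  have hint : (algebraMap M Ω).IsIntegral :=
    RingHom.IsIntegral.tower_top (i.codRestrict M fun a => hM ⟨a, rfl⟩) _ hα
  have := isGalois_of_isIntegral hint
  by_contra! h
  have h1 : α l ∈ Set.range (algebraMap M Ω) := by
    rw [InfiniteGalois.mem_range_algebraMap_iff_fixed]
    exact fun σ => h σ.toRingEquiv σ.commutes
  obtain ⟨m, hm⟩ := h1
  exact hl (α.injective hm ▸ m.2)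

omit [CharZero F] in
/-- Two embeddings over `F` are conjugate. -/
theorem exists_ringAut_comp_eq (p q : L →+* Ω) (hp : (p.comp i).IsIntegral)
    (hpq : p.comp i = q.comp i) : ∃ σ : RingAut Ω, (σ : Ω →+* Ω).comp p = q := by
  algebraize [i, p, p.comp i]
  have : Algebra.IsIntegral F Ω := ⟨hp⟩
  have : Algebra.IsAlgebraic F Ω := inferInstance
  have : Algebra.IsAlgebraic L Ω := Algebra.IsAlgebraic.tower_top (K := F) L
  let q' : L →ₐ[F] Ω := { q with commutes' := fun a => (RingHom.congr_fun hpq a).symm }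
  obtain ⟨σ, hσ⟩ := IsAlgClosed.surjective_domRestrict_of_isAlgebraic (K := F) (L := L)
    (E := Ω) (M := Ω) q'
  refine ⟨(AlgEquiv.ofBijective σ (Algebra.IsAlgebraic.algHom_bijective σ)).toRingEquiv,
    RingHom.ext fun l => ?_⟩
  exact DFunLike.congr_fun hσ l

omit [CharZero F] [IsAlgClosed Ω] in
theorem finite_emb (hi : i.Finite) (x : F →+* Ω) : Finite (Emb i x) := by
  algebraize [i, x]
  have : FiniteDimensional F L := hi
  refine Finite.of_injective (fun p : Emb i x =>
    ({ p.1 with commutes' := fun a => RingHom.congr_fun p.2 a } : L →ₐ[F] Ω)) ?_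
  intro p q h
  exact Subtype.ext (RingHom.ext fun l => DFunLike.congr_fun h l)

/-- In an invariant tower, groups properly containing the stabilizer of an embedding `α` of the
top field contain automorphisms over the middle field that move `α`. -/
theorem exists_mem_of_invariant {E : Type*} [Field E] (g : F →+* E) (h : E →+* L)
    (hfin : (h.comp g).Finite) (α : L →+* Ω) (hα : (α.comp (h.comp g)).IsIntegral)
    (hinv : ∀ M : Subfield L, (h.comp g).fieldRange ≤ M → M ≠ ⊤ →
      ∃ M' : Subfield L, M ≤ M' ∧ h.fieldRange ≤ M' ∧ M' ≠ ⊤)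
    {H : Subgroup (RingAut Ω)} (h1 : galGroup α ≤ H) (h2 : H ≤ galGroup (α.comp (h.comp g)))
    (h3 : ∃ σ ∈ H, σ ∉ galGroup α) : ∃ σ ∈ H, σ ∈ galGroup (α.comp h) ∧ σ ∉ galGroup α := by
  have hne : fixedSubfield α H ≠ ⊤ := by
    rintro h0
    obtain ⟨σ, hσ, hσα⟩ := h3
    refine hσα fun l => ?_
    have : l ∈ fixedSubfield α H := h0 ▸ Subfield.mem_top l
    exact this σ hσ
  have hle := fieldRange_le_fixedSubfield _ α h2
  obtain ⟨M', hM1, hM2, hM3⟩ := hinv _ hle hne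
  obtain ⟨l, hl⟩ : ∃ l, l ∉ M' := by
    by_contra! hcon
    exact hM3 (eq_top_iff.mpr fun l _ => hcon l)
  obtain ⟨σ, hσ, hσl⟩ := exists_mem_galGroup_ne _ α hα (hle.trans hM1) hl
  refine ⟨σ, ?_, fun a => hσ ⟨h a, hM2 ⟨a, rfl⟩⟩, fun h0 => hσl (h0 l)⟩
  -- σ fixes `M'`, which contains the fixed field of `H`, so it lies in `H`.
  rw [← galGroup_fixedSubfield _ hfin α hα h1 h2]
  exact fun m => hσ ⟨m, hM1 m.2⟩

end Galois

/-! ### Kernels of Galois groups -/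

/-- Two homomorphisms with the same kernel have isomorphic images. In this form an embedding of a
monodromy group is refuted by comparing kernels on the group acting. -/
theorem embedsIn_range {Γ P S : Type*} [Group Γ] [Group P] [Group S] (ρ : Γ →* P) (φ : Γ →* S)
    (h : ∀ γ, ρ γ = 1 ↔ φ γ = 1) : EmbedsIn ρ.range S := by
  have hker : ρ.rangeRestrict.ker = φ.ker := by
    ext γ
    rw [MonoidHom.ker_rangeRestrict, MonoidHom.mem_ker, MonoidHom.mem_ker, h]
  refine ⟨ρ.rangeRestrict.liftOfSurjective ρ.rangeRestrict_surjective ⟨φ, hker.le⟩, ?_⟩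
  rw [injective_iff_map_eq_one]
  intro x hx
  obtain ⟨γ, rfl⟩ := ρ.rangeRestrict_surjective x
  have h1 := MonoidHom.liftOfRightInverse_comp_apply ρ.rangeRestrict _
    (Function.rightInverse_surjInv ρ.rangeRestrict_surjective) ⟨φ, hker.le⟩ γ
  have h2 : φ γ = 1 := h1.symm.trans hx
  have : γ ∈ ρ.rangeRestrict.ker := hker ▸ h2
  exact this

section Field

variable {F E L Ω : Type*} [Field F] [Field E] [Field L] [Field Ω]

theorem embAction_eq_self_iff {i : F →+* L} {x : F →+* Ω} {σ : galGroup x} {p : Emb i x} :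
    embAction i x σ p = p ↔ σ.1 ∈ galGroup p.1 := by
  exact ⟨fun h a => RingHom.congr_fun (congrArg Subtype.val h) a,
    fun h => Subtype.ext (RingHom.ext h)⟩

omit [Field E] in
-- Allows the base field to be replaced by an isomorphic copy, needed when a subfield of E is
-- regarded as an intermediate field of L / F.
theorem embedsIn_galoisGroup_comp {M : Type*} [Field M] {i : F →+* L} {x : F →+* Ω} {e : M →+* F}
    (he : Function.Surjective e) {S : Type*} [Group S]
    (h : EmbedsIn (galoisGroup (i.comp e) (x.comp e)) S) : EmbedsIn (galoisGroup i x) S := by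
  obtain ⟨ψ, hψ⟩ := h
  have hle : galGroup x ≤ galGroup (x.comp e) := fun σ hσ a => hσ (e a)
  refine embedsIn_range _ ((ψ.comp (embAction (i.comp e) (x.comp e)).rangeRestrict).comp
    (Subgroup.inclusion hle)) fun γ => ?_
  have hiff : ψ ((embAction (i.comp e) (x.comp e)).rangeRestrict (Subgroup.inclusion hle γ)) = 1 ↔
      embAction (i.comp e) (x.comp e) (Subgroup.inclusion hle γ) = 1 :=
    (map_eq_one_iff ψ hψ).trans Subtype.ext_iff
  refine Iff.trans ?_ hiff.symm
  constructor
  · intro h1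
    refine Equiv.ext fun p => embAction_eq_self_iff.mpr ?_
    let q : Emb i x := ⟨p.1, RingHom.ext fun a => by
      obtain ⟨b, rfl⟩ := he a
      exact RingHom.congr_fun p.2 b⟩
    have hq := embAction_eq_self_iff.mp (Equiv.congr_fun h1 q)
    exact hq
  · intro h1
    refine Equiv.ext fun p => embAction_eq_self_iff.mpr ?_
    let q : Emb (i.comp e) (x.comp e) := ⟨p.1, by rw [← RingHom.comp_assoc, p.2]⟩
    have hq := embAction_eq_self_iff.mp (Equiv.congr_fun h1 q)
    exact hq

/-- If the Galois closure of `E / F` is a proper subfield of that of `L / F`, then the kernel is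
nontrivial. -/
theorem exists_mem_ker_of_galClosure_lt [CharZero F] [IsAlgClosed Ω] (g : F →+* E) (h : E →+* L)
    (x : F →+* Ω) (hx : x.IsIntegral) (hne : Nonempty (Emb g x))
    (hlt : galClosure g x < galClosure (h.comp g) x) :
    ∃ γ, embAction g x γ = 1 ∧ embAction (h.comp g) x γ ≠ 1 := by
  obtain ⟨z, hz, hz'⟩ := SetLike.exists_of_lt hlt
  have hle : x.fieldRange ≤ galClosure g x := by
    obtain ⟨p⟩ := hne
    rintro _ ⟨a, rfl⟩
    refine (le_iSup (fun p : Emb g x => p.1.fieldRange) p) ⟨g a, ?_⟩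
    exact RingHom.congr_fun p.2 a
  obtain ⟨σ, hσ, hσz⟩ := exists_mem_galGroup_ne x (RingHom.id Ω) hx hle hz'
  refine ⟨⟨σ, fun a => hσ ⟨x a, hle ⟨a, rfl⟩⟩⟩, ?_, fun h1 => hσz ?_⟩
  · refine Equiv.ext fun p => embAction_eq_self_iff.mpr fun a => ?_
    exact hσ ⟨p.1 a, (le_iSup (fun p : Emb g x => p.1.fieldRange) p) ⟨a, rfl⟩⟩
  · have : galClosure (h.comp g) x ≤ (σ : Ω →+* Ω).eqLocusField (RingHom.id Ω) := by
      refine iSup_le fun p => ?_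
      rintro _ ⟨a, rfl⟩
      exact embAction_eq_self_iff.mp (Equiv.congr_fun h1 p) a
    exact this hz

variable [CharZero F] [IsAlgClosed Ω]

omit [CharZero F] in
theorem embAction_transitive (i : F →+* L) (x : F →+* Ω) (hx : x.IsIntegral)
    (p q : Emb i x) : ∃ σ, embAction i x σ p = q := by
  obtain ⟨σ, hσ⟩ := exists_ringAut_comp_eq i p.1 q.1 (by rw [p.2]; exact hx) (p.2.trans q.2.symm)
  refine ⟨⟨σ, fun a => ?_⟩, Subtype.ext hσ⟩
  have h1 := RingHom.congr_fun hσ (i a)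
  have h2 := RingHom.congr_fun p.2 a
  have h3 := RingHom.congr_fun q.2 a
  simp only [RingHom.comp_apply] at h1 h2 h3
  rw [← h2]
  exact h1.trans (h3.trans h2.symm)

omit [CharZero F] in
theorem exists_extension (i : F →+* L) (hi : i.IsIntegral) (x : F →+* Ω) :
    ∃ p : L →+* Ω, p.comp i = x := by
  algebraize [i, x]
  have : Algebra.IsIntegral F L := ⟨hi⟩
  exact ⟨(IsAlgClosed.lift : L →ₐ[F] Ω).toRingHom, RingHom.ext (IsAlgClosed.lift : L →ₐ[F] Ω).commutes⟩

/-- The kernel attached to a tower of fields is large under the hypotheses of invariance,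
conjugation compatibility, Galois-properness over the ground field and non-embeddability. -/
theorem isLarge_galKerPi (g : F →+* E) (h : E →+* L) (y : E →+* Ω) (hfin : (h.comp g).Finite)
    (hy : (y.comp g).IsIntegral)
    (hinv : ∀ M : Subfield L, (h.comp g).fieldRange ≤ M → M ≠ ⊤ →
      ∃ M' : Subfield L, M ≤ M' ∧ h.fieldRange ≤ M' ∧ M' ≠ ⊤)
    (hsoc : SocleNonabelianMinimalNormal (galoisGroup h y))
    (hcc : IsConjCompatible (fun j : Emb g (y.comp g) => galoisGroup h j.1)
      (galKerPi g h (y.comp g)))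
    (hker : (∃ a, a ∉ g.fieldRange) → ∃ γ, embAction g (y.comp g) γ = 1 ∧
      embAction (h.comp g) (y.comp g) γ ≠ 1)
    (hemb : ∀ M : Subfield E, g.fieldRange ≤ M → M ≠ ⊤ →
      ¬ EmbedsIn (galoisGroup (h.comp M.subtype) (y.comp M.subtype))
        (MulAut (socle (galoisGroup h y)))) :
    IsLarge (fun j : Emb g (y.comp g) => galoisGroup h j.1) (galKerPi g h (y.comp g)) := by
  set x := y.comp g with hx
  have hgi : g.Finite := by
    algebraize [g, h, h.comp g]
    have : Module.Finite F L := hfin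
    exact (Module.Finite.of_injective (IsScalarTower.toAlgHom F E L).toLinearMap h.injective :
      Module.Finite F E)
  have hhi : h.IsIntegral := RingHom.IsIntegral.tower_top g h hfin.to_isIntegral
  obtain ⟨α, hα⟩ := exists_extension h hhi y
  have hαx : α.comp (h.comp g) = x := by rw [← RingHom.comp_assoc, hα]
  have hα' : (α.comp (h.comp g)).IsIntegral := by rw [hαx]; exact hy
  have := finite_emb g hgi x
  have := finite_emb (h.comp g) hfin x
  refine isLarge_of_blocks (embEquiv g h x) (fun j => galoisGroup h j.1)
    (embAction (h.comp g) x) (embAction g x) (fun _ _ => rfl)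
    (embAction_transitive _ _ hy) (embAction_transitive _ _ hy) ?_ ?_ _ ?_
    ⟨y, rfl⟩ ⟨α, hαx⟩ (Subtype.ext hα) ?_ hsoc hcc ?_ ?_
  · intro j γ hγ
    have hγj := embAction_eq_self_iff.mp hγ
    exact ⟨⟨embAction h j.1 ⟨γ.1, hγj⟩, ⟨_, rfl⟩⟩, fun β => rfl⟩
  · rintro j ⟨_, γ, rfl⟩
    have hγ : γ.1 ∈ galGroup x := fun a => by
      have h1 : j.1 (g a) = x a := RingHom.congr_fun j.2 a
      exact h1 ▸ γ.2 (g a)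
    exact ⟨⟨γ.1, hγ⟩, embAction_eq_self_iff.mpr γ.2, fun β => rfl⟩
  · exact fun w => Iff.rfl
  · intro H h1 h2
    obtain ⟨σ, ⟨τ, hτ, rfl⟩, hσ1, hσ2⟩ := exists_mem_of_invariant g h hfin α hα' hinv
      (H := H.map (galGroup x).subtype)
      (fun σ hσ => ⟨⟨σ, fun a => by rw [← hαx]; exact hσ _⟩, h1 _
        (embAction_eq_self_iff.mpr hσ), rfl⟩)
      (by rw [hαx]; exact Subgroup.map_subtype_le H)
      (by
        obtain ⟨γ, hγ, hγα⟩ := h2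
        exact ⟨γ, ⟨γ, hγ, rfl⟩, fun h0 => hγα (embAction_eq_self_iff.mpr h0)⟩)
    refine ⟨τ, hτ, embAction_eq_self_iff.mpr ?_, fun h0 => hσ2 (embAction_eq_self_iff.mp h0)⟩
    rw [hα] at hσ1
    exact hσ1
  · rintro ⟨j, hj⟩
    apply hker
    by_contra! hcon
    refine hj (Subtype.ext (RingHom.ext fun a => ?_))
    obtain ⟨b, rfl⟩ := hcon a
    exact RingHom.congr_fun j.2 b
  · intro H h1 h2 φ hφ
    set H' : Subgroup (RingAut Ω) := H.map (galGroup x).subtype with hH'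
    have hH1 : galGroup y ≤ H' := fun σ hσ =>
      ⟨⟨σ, fun a => hσ (g a)⟩, h1 _ (embAction_eq_self_iff.mpr hσ), rfl⟩
    have hH2 : H' ≤ galGroup (y.comp g) := Subgroup.map_subtype_le H
    -- `H` is the group of Ω over M, and the embeddings of L over M form the `H`-orbit of α. So φ
    -- having the kernel of that action would embed the Galois group of L / M.
    set M := fixedSubfield y H' with hM
    have hcorr : galGroup (y.comp M.subtype) = H' :=
      galGroup_fixedSubfield g hgi y hy hH1 hH2
    refine hemb M (fieldRange_le_fixedSubfield g y hH2) ?_ ?_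
    · intro h0
      obtain ⟨γ, hγ, hγy⟩ := h2
      refine hγy (embAction_eq_self_iff.mpr fun a => ?_)
      have : a ∈ M := h0 ▸ Subfield.mem_top a
      exact this γ ⟨γ, hγ, rfl⟩
    · let ε : H ≃* galGroup (y.comp M.subtype) :=
        (H.equivMapOfInjective _ (galGroup x).subtype_injective).trans
          (MulEquiv.subgroupCongr hcorr.symm)
      have hε : ∀ γ : H, (ε γ).1 = γ.1.1 := fun γ => rfl
      refine embedsIn_range _ (φ.comp ε.symm.toMonoidHom) fun γ => ?_
      obtain ⟨γ, rfl⟩ := ε.surjective γ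
      have : (φ.comp ε.symm.toMonoidHom) (ε γ) = φ γ := by simp
      rw [this, hφ]
      constructor
      · intro hγ δ hδ
        let p : Emb (h.comp M.subtype) (y.comp M.subtype) :=
          ⟨((δ.1 : RingAut Ω) : Ω →+* Ω).comp α, by
            refine RingHom.ext fun m => ?_
            have h1 : α (h m) = y m := RingHom.congr_fun hα m
            change δ.1 (α (h m)) = y m
            rw [h1]
            exact m.2 δ.1 ⟨δ, hδ, rfl⟩⟩
        have h1 : embAction _ _ (ε γ) p = p := by rw [hγ, Equiv.Perm.one_apply]
        have h2 := embAction_eq_self_iff.mp h1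
        exact embAction_eq_self_iff.mpr h2
      · intro hγ
        refine Equiv.ext fun p => Subtype.ext ?_
        have hαM : α.comp (h.comp M.subtype) = y.comp M.subtype := by
          rw [← RingHom.comp_assoc, hα]
        have hint : (α.comp (h.comp M.subtype)).IsIntegral := by
          rw [hαM]
          refine RingHom.IsIntegral.tower_top
            (g.codRestrict M fun a => fieldRange_le_fixedSubfield g y hH2 ⟨a, rfl⟩) _ hy
        obtain ⟨δ, hδ⟩ := embAction_transitive (h.comp M.subtype) (y.comp M.subtype)
          (hαM ▸ hint) ⟨α, hαM⟩ p
        obtain ⟨δ, rfl⟩ := ε.surjective δ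
        have h2 := Subtype.ext_iff.mp (hγ δ δ.2)
        rw [← hδ]
        exact h2

end Field

/-- The kernel attached to a tower of fields `F ⊆ E ⊆ L` is large if `E` is invariant and
conjugation-compatible. -/
theorem isLarge_of_isInvariantIntermediate {F : Type u} {L : Type v} [Field F] [CharZero F]
    [Field L] [Algebra F L] [FiniteDimensional F L] (E : IntermediateField F L)
    {Ω : Type*} [Field Ω] [IsAlgClosed Ω] (y : E →+* Ω) (hy : y.IsIntegral)
    (hinv : IsInvariantIntermediate E)
    (hsoc : SocleNonabelianMinimalNormal (galoisGroup (algebraMap E L) y))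
    (hcc : IsConjCompatible
      (fun j : Emb (algebraMap F E) (y.comp (algebraMap F E)) => galoisGroup (algebraMap E L) j.1)
      (galKerPi (algebraMap F E) (algebraMap E L) (y.comp (algebraMap F E))))
    (hM : ∀ (M : IntermediateField F L) (hM : M < E),
      letI i : M →+* E := (IntermediateField.inclusion hM.le).toRingHom
      galClosure i (y.comp i) < galClosure ((algebraMap E L).comp i) (y.comp i) ∧
        ¬ EmbedsIn (galoisGroup ((algebraMap E L).comp i) (y.comp i))
          (MulAut (socle (galoisGroup (algebraMap E L) y)))) :
    IsLarge
      (fun j : Emb (algebraMap F E) (y.comp (algebraMap F E)) => galoisGroup (algebraMap E L) j.1)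
      (galKerPi (algebraMap F E) (algebraMap E L) (y.comp (algebraMap F E))) := by
  have hcomp : (algebraMap E L).comp (algebraMap F E) = algebraMap F L := rfl
  have hyF : (y.comp (algebraMap F E)).IsIntegral :=
    RingHom.IsIntegral.trans _ _ (algebraMap_isIntegral_iff.mpr inferInstance) hy
  refine isLarge_galKerPi _ _ y ?_ hyF ?_ hsoc hcc ?_ ?_
  · rw [hcomp, RingHom.finite_algebraMap]
    infer_instance
  · intro M hle hne
    let M₀ : IntermediateField F L := { M with algebraMap_mem' := fun a => hle ⟨a, rfl⟩ }
    refine ⟨(E ⊔ M₀).toSubfield, ?_, ?_, ?_⟩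
    · exact fun a ha => (le_sup_right : M₀ ≤ E ⊔ M₀) ha
    · rintro _ ⟨a, rfl⟩
      exact (le_sup_left : E ≤ E ⊔ M₀) a.2
    · intro h0
      refine hinv M₀ (fun h1 => hne ?_) ?_
      · exact congrArg IntermediateField.toSubfield h1
      · exact eq_top_iff.mpr fun a _ => by
          have : a ∈ (E ⊔ M₀).toSubfield := h0 ▸ Subfield.mem_top a
          exact this
  · rintro ⟨a, ha⟩
    -- Properness of the Galois closure is used at M = F, here the bottom intermediate field; the
    -- kernel element found there is transported along F ≅ ⊥.
    have hlt : (⊥ : IntermediateField F L) < E := by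
      refine lt_of_le_of_ne bot_le fun h0 => ha ?_
      have h1 : (a : L) ∈ (⊥ : IntermediateField F L) := h0 ▸ a.2
      obtain ⟨b, hb⟩ := IntermediateField.mem_bot.mp h1
      exact ⟨b, Subtype.ext hb⟩
    obtain ⟨h1, -⟩ := hM ⊥ hlt
    set i : (⊥ : IntermediateField F L) →+* E :=
      (IntermediateField.inclusion hlt.le).toRingHom with hi
    have hbot : ∀ b : (⊥ : IntermediateField F L), ∃ c : F, i b = algebraMap F E c := by
      rintro ⟨b, hb⟩
      obtain ⟨c, rfl⟩ := IntermediateField.mem_bot.mp hb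
      exact ⟨c, rfl⟩
    have hicomp : i.comp (algebraMap F (⊥ : IntermediateField F L)) = algebraMap F E := rfl
    have : CharZero (⊥ : IntermediateField F L) := charZero_of_ringHom (algebraMap F _)
    have hyi : (y.comp i).IsIntegral :=
      RingHom.IsIntegral.tower_top (algebraMap F (⊥ : IntermediateField F L)) _ hyF
    obtain ⟨γ, hγ1, hγ2⟩ := exists_mem_ker_of_galClosure_lt i (algebraMap E L) (y.comp i) hyi
      ⟨⟨y, rfl⟩⟩ h1
    refine ⟨⟨γ.1, fun a => γ.2 (algebraMap F _ a)⟩, ?_, fun h2 => hγ2 ?_⟩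
    · refine Equiv.ext fun p => embAction_eq_self_iff.mpr ?_
      let q : Emb i (y.comp i) := ⟨p.1, RingHom.ext fun b => by
        obtain ⟨c, hc⟩ := hbot b
        rw [RingHom.comp_apply, RingHom.comp_apply, hc]
        exact RingHom.congr_fun p.2 c⟩
      have hq := embAction_eq_self_iff.mp (Equiv.congr_fun hγ1 q)
      exact hq
    · refine Equiv.ext fun p => embAction_eq_self_iff.mpr ?_
      let q : Emb ((algebraMap E L).comp (algebraMap F E)) (y.comp (algebraMap F E)) :=
        ⟨p.1, RingHom.ext fun c => RingHom.congr_fun p.2 (algebraMap F _ c)⟩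
      have hq := embAction_eq_self_iff.mp (Equiv.congr_fun h2 q)
      exact hq
  · intro M hle hne hemb
    let M₀ : IntermediateField F L :=
      { M.map (algebraMap E L) with algebraMap_mem' := fun a => ⟨_, hle ⟨a, rfl⟩, rfl⟩ }
    have hM₀ : ∀ a : E, (a : L) ∈ M₀ ↔ a ∈ M := fun a =>
      ⟨fun ⟨b, hb, hba⟩ => (Subtype.ext hba : b = a) ▸ hb, fun ha => ⟨a, ha, rfl⟩⟩
    have hME : M₀ ≤ E := by
      rintro _ ⟨a, -, rfl⟩
      exact a.2
    have hlt : M₀ < E := lt_of_le_of_ne hME fun h0 => hne <| eq_top_iff.mpr fun a _ =>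
      (hM₀ a).mp (h0.ge a.2)
    refine (hM M₀ hlt).2 ?_
    let e : M →+* M₀ := ((algebraMap E L).comp M.subtype).codRestrict M₀ fun a => (hM₀ a).mpr a.2
    have he : Function.Surjective e := by
      rintro ⟨_, a, ha, rfl⟩
      exact ⟨⟨a, ha⟩, rfl⟩
    exact embedsIn_galoisGroup_comp he hemb

/-! ### Function fields and generic points -/

/-- If `A` is finite over `R`, then so is the field of fractions of `A` over that of `R`. -/
theorem finite_of_isFractionRing (R A K L : Type*) [CommRing R] [CommRing A] [Field K] [Field L]
    [Algebra R A] [Algebra K L] [Algebra R K] [Algebra A L] [Algebra R L] [IsScalarTower R A L]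
    [IsScalarTower R K L] [IsFractionRing A L] [Module.Finite R A] : Module.Finite K L := by
  obtain ⟨s, hs⟩ := (inferInstance : Module.Finite R A)
  -- Adjoining the finitely many integral generators of A to K gives a field containing A, hence all
  -- fractions, that is L.
  have hfin : FiniteDimensional K (IntermediateField.adjoin K (algebraMap A L '' s)) := by
    refine IntermediateField.finiteDimensional_adjoin (K := K) (L := L)
      (S := algebraMap A L '' s) ?_
    rintro _ ⟨a, -, rfl⟩
    exact ((Algebra.IsIntegral.isIntegral (R := R) a).map
      (IsScalarTower.toAlgHom R A L)).tower_top
  have hA : ∀ a : A, algebraMap A L a ∈ IntermediateField.adjoin K (algebraMap A L '' s) := by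
    intro a
    have ha : a ∈ Submodule.span R (s : Set A) := hs ▸ Submodule.mem_top
    induction ha using Submodule.span_induction with
    | mem b hb => exact IntermediateField.subset_adjoin K _ ⟨b, hb, rfl⟩
    | zero => rw [map_zero]; exact zero_mem _
    | add b c _ _ hb hc => rw [map_add]; exact add_mem hb hc
    | smul r b _ hb =>
      rw [Algebra.smul_def, map_mul, ← IsScalarTower.algebraMap_apply R A L]
      exact mul_mem ((IsScalarTower.algebraMap_apply R K L r).symm ▸
        IntermediateField.algebraMap_mem _ _) hb
  have htop : IntermediateField.adjoin K (algebraMap A L '' s) = ⊤ := by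
    refine eq_top_iff.mpr fun l _ => ?_
    obtain ⟨a, b, -, rfl⟩ := IsFractionRing.div_surjective (A := A) l
    exact div_mem (hA a) (hA b)
  rw [htop] at hfin
  exact Module.Finite.equiv IntermediateField.topEquiv.toLinearEquiv

section Scheme

variable {X Y Z : Scheme.{u}}

theorem map_genericPoint [IrreducibleSpace X] [IrreducibleSpace Y] (f : X ⟶ Y) [IsDominant f] :
    f (genericPoint X) = genericPoint Y := by
  have h := (genericPoint_spec X).image f.continuous
  rw [Set.image_univ, f.denseRange.closure_range] at h
  exact h.eq (genericPoint_spec Y)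

/-- The map of function fields induced by a dominant morphism. -/
def ffMap [IsIntegral X] [IsIntegral Y] (f : X ⟶ Y) [IsDominant f] :
    Y.functionField ⟶ X.functionField :=
  Y.presheaf.stalkSpecializes (specializes_of_eq (map_genericPoint f)) ≫
    f.stalkMap (genericPoint X)

/-- The inclusion of the generic point. -/
abbrev genericMap (X : Scheme.{u}) [IsIntegral X] : Spec X.functionField ⟶ X :=
  X.fromSpecStalk (genericPoint X)

theorem genericMap_comp [IsIntegral X] [IsIntegral Y] (f : X ⟶ Y) [IsDominant f] :
    genericMap X ≫ f = Spec.map (ffMap f) ≫ genericMap Y := by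
  rw [ffMap, Spec.map_comp, Category.assoc, Scheme.SpecMap_stalkSpecializes_fromSpecStalk,
    Scheme.SpecMap_stalkMap_fromSpecStalk]

/-- The inclusion of the generic point is a monomorphism, so maps of function fields can be compared
as morphisms of schemes. -/
theorem ffMap_eq_iff [IsIntegral X] [IsIntegral Y] (f : X ⟶ Y) [IsDominant f]
    {φ : Y.functionField ⟶ X.functionField} :
    ffMap f = φ ↔ genericMap X ≫ f = Spec.map φ ≫ genericMap Y := by
  rw [genericMap_comp, cancel_mono, Spec.map_inj]

theorem ffMap_comp [IsIntegral X] [IsIntegral Y] [IsIntegral Z] (f : X ⟶ Y) [IsDominant f]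
    (g : Y ⟶ Z) [IsDominant g] : ffMap (f ≫ g) = ffMap g ≫ ffMap f := by
  rw [ffMap_eq_iff, ← Category.assoc, genericMap_comp f, Category.assoc, genericMap_comp g,
    Spec.map_comp, Category.assoc]

/-- On an affine neighbourhood of the generic point the morphism is a finite ring map, and
finiteness passes to fraction fields. -/
theorem ffMap_finite [IsIntegral X] [IsIntegral Y] (f : X ⟶ Y) [IsDominant f] [IsFinite f] :
    (ffMap f).hom.Finite := by
  obtain ⟨_, ⟨U, hU, rfl⟩, hyU, -⟩ := Y.isBasis_affineOpens.exists_subset_of_mem_open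
    (Set.mem_univ (genericPoint Y)) isOpen_univ
  have hxU : genericPoint X ∈ f ⁻¹ᵁ U := by
    change f (genericPoint X) ∈ U
    rw [map_genericPoint f]
    exact hyU
  have : Nonempty U := ⟨⟨_, hyU⟩⟩
  have : Nonempty (f ⁻¹ᵁ U) := ⟨⟨_, hxU⟩⟩
  have hV : IsAffineOpen (f ⁻¹ᵁ U) := hU.preimage f
  have hfin := IsFinite.finite_app (f := f) U hU
  have := functionField_isFractionRing_of_isAffineOpen X (f ⁻¹ᵁ U) hV
  have hcomm : f.app U ≫ X.presheaf.germ (f ⁻¹ᵁ U) _ hxU =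
      Y.presheaf.germ U _ hyU ≫ ffMap f := by
    rw [ffMap, TopCat.Presheaf.germ_stalkSpecializes_assoc, Scheme.Hom.germ_stalkMap]
  let : Algebra Γ(Y, U) Γ(X, f ⁻¹ᵁ U) := (f.app U).hom.toAlgebra
  let : Algebra Y.functionField X.functionField := (ffMap f).hom.toAlgebra
  let : Algebra Γ(Y, U) X.functionField := (f.app U ≫ X.presheaf.germ (f ⁻¹ᵁ U) _ hxU).hom.toAlgebra
  have : IsScalarTower Γ(Y, U) Γ(X, f ⁻¹ᵁ U) X.functionField := .of_algebraMap_eq' rfl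
  have : IsScalarTower Γ(Y, U) Y.functionField X.functionField :=
    .of_algebraMap_eq' (congrArg CommRingCat.Hom.hom hcomm)
  have : Module.Finite Γ(Y, U) Γ(X, f ⁻¹ᵁ U) := hfin
  exact finite_of_isFractionRing Γ(Y, U) Γ(X, f ⁻¹ᵁ U) Y.functionField X.functionField

/-- `degree` uses the stalk at the image of the generic point; that point equals the generic point
of `Y`, and the two stalks are identified by a ring isomorphism. -/
theorem degree_eq_finrank [IsIntegral X] [IsIntegral Y] (f : X ⟶ Y) [IsDominant f] :
    degree f = letI := (ffMap f).hom.toAlgebra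
      Module.finrank Y.functionField X.functionField := by
  let := (f.stalkMap (genericPoint X)).hom.toAlgebra
  let := (ffMap f).hom.toAlgebra
  have : IsIso (Y.presheaf.stalkSpecializes (specializes_of_eq (map_genericPoint f))) :=
    (Y.presheaf.stalkCongr (.of_eq (map_genericPoint f).symm)).isIso_hom
  symm
  exact Algebra.finrank_eq_of_equiv_equiv (asIso (Y.presheaf.stalkSpecializes
    (specializes_of_eq (map_genericPoint f)))).commRingCatIsoToRingEquiv
    (RingEquiv.refl X.functionField) rfl

theorem one_lt_degree_iff [IsIntegral X] [IsIntegral Y] (f : X ⟶ Y) [IsDominant f] [IsFinite f] :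
    1 < degree f ↔ ¬ Function.Surjective (ffMap f) := by
  rw [degree_eq_finrank]
  have hfin := ffMap_finite f
  let : Algebra Y.functionField X.functionField := (ffMap f).hom.toAlgebra
  have : Module.Finite Y.functionField X.functionField := hfin
  have h0 : 0 < Module.finrank Y.functionField X.functionField := Module.finrank_pos
  have h1 : Module.finrank Y.functionField X.functionField = 1 ↔
      Function.Surjective (algebraMap Y.functionField X.functionField) := by
    rw [← Subalgebra.bot_eq_top_iff_finrank_eq_one, eq_top_iff, SetLike.le_def]
    exact ⟨fun h l => Algebra.mem_bot.mp (h Algebra.mem_top),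
      fun h l _ => Algebra.mem_bot.mpr (h l)⟩
  change 1 < Module.finrank Y.functionField X.functionField ↔
    ¬ Function.Surjective (algebraMap Y.functionField X.functionField)
  rw [← h1]
  omega

/-! ### Geometric generic points -/

variable {Ω : Type u} [Field Ω]

/-- The geometric point over the generic point attached to an embedding of the function field. -/
def point (X : Scheme.{u}) [IsIntegral X] (φ : X.functionField →+* Ω) : Spec (.of Ω) ⟶ X :=
  Spec.map (CommRingCat.ofHom φ) ≫ genericMap X

theorem point_comp [IsIntegral X] [IsIntegral Y] (f : X ⟶ Y) [IsDominant f]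
    (φ : X.functionField →+* Ω) : point X φ ≫ f = point Y (φ.comp (ffMap f).hom) := by
  rw [point, Category.assoc, genericMap_comp, point, CommRingCat.ofHom_comp, Spec.map_comp,
    Category.assoc]
  rfl

theorem point_injective [IsIntegral X] : Function.Injective (point (Ω := Ω) X) := by
  intro φ ψ h
  rw [point, point, cancel_mono, Spec.map_inj] at h
  exact congrArg CommRingCat.Hom.hom h

theorem SpecMap_comp_point [IsIntegral X] {Ω' : Type u} [Field Ω'] (φ : X.functionField →+* Ω)
    (s : Ω →+* Ω') :
    Spec.map (CommRingCat.ofHom s) ≫ point X φ = point X (s.comp φ) := by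
  rw [point, point, ← Category.assoc, ← Spec.map_comp]
  rfl

theorem point_apply [IsIntegral X] (φ : X.functionField →+* Ω) (t : Spec (.of Ω)) :
    point X φ t = genericPoint X := by
  have : Subsingleton (Spec (.of Ω)) := inferInstanceAs (Subsingleton (PrimeSpectrum Ω))
  have : Subsingleton (Spec X.functionField) :=
    inferInstanceAs (Subsingleton (PrimeSpectrum X.functionField))
  rw [point, Scheme.Hom.comp_apply, Subsingleton.elim (Spec.map _ t) (IsLocalRing.closedPoint _)]
  exact Scheme.fromSpecStalk_closedPoint

/-- A morphism from the spectrum of a field factors through the stalk at its image point, here the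
function field. -/
theorem exists_eq_point [IsIntegral X] (p : Spec (.of Ω) ⟶ X)
    (hp : ∀ t, p t = genericPoint X) : ∃ φ, p = point X φ := by
  have h := Scheme.Spec_stalkClosedPointTo_fromSpecStalk p
  have h1 : genericPoint X ⤳ p (IsLocalRing.closedPoint Ω) := genericPoint_specializes _
  have h2 : p (IsLocalRing.closedPoint Ω) ⤳ genericPoint X := specializes_of_eq (hp _)
  refine ⟨(X.presheaf.stalkSpecializes h2 ≫ Scheme.stalkClosedPointTo p).hom, ?_⟩
  rw [point, CommRingCat.ofHom_hom, Spec.map_comp, Category.assoc,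
    Scheme.SpecMap_stalkSpecializes_fromSpecStalk]
  exact h.symm

/-- Fibres of a finite morphism are discrete, while the generic point specializes to every point of
its fibre. -/
theorem eq_genericPoint_of_map_eq [IsIntegral X] [IsIntegral Y] (f : X ⟶ Y) [IsDominant f]
    [IsFinite f] {x : X} (hx : f x = genericPoint Y) : x = genericPoint X := by
  have h := f.isDiscrete_preimage_singleton (genericPoint Y)
  have h1 : DiscreteTopology (f ⁻¹' {genericPoint Y}) := h.to_subtype
  have h2 : (⟨genericPoint X, map_genericPoint f⟩ : f ⁻¹' {genericPoint Y}) ⤳ ⟨x, hx⟩ := by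
    rw [← Topology.IsInducing.subtypeVal.specializes_iff]
    exact genericPoint_specializes x
  exact (congrArg Subtype.val h2.eq).symm

/-- Identifies the fibre over a geometric generic point with the embeddings of the function field;
the dictionary between monodromy and Galois groups rests on this. -/
theorem exists_eq_point_of_comp [IsIntegral X] [IsIntegral Y] (f : X ⟶ Y) [IsDominant f]
    [IsFinite f] {p : Spec (.of Ω) ⟶ X} {ζ : Y.functionField →+* Ω} (hp : p ≫ f = point Y ζ) :
    ∃ φ : X.functionField →+* Ω, p = point X φ ∧ φ.comp (ffMap f).hom = ζ := by
  obtain ⟨φ, rfl⟩ := exists_eq_point p fun t => eq_genericPoint_of_map_eq f (by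
    rw [← Scheme.Hom.comp_apply, hp, point_apply])
  refine ⟨φ, rfl, point_injective ?_⟩
  rw [← hp, point_comp]

end Scheme

/-! ### Normalization in an extension of the function field -/

section Normalization

variable {X Y Z : Scheme.{u}} {M : Type u} [Field M]

/-- Sections over the whole spectrum of a field. -/
def fieldSectionsIso {W : (Spec (.of M)).Opens} (hW : W = ⊤) :
    Γ(Spec (.of M), W) ≅ .of M :=
  (Spec (.of M)).presheaf.mapIso (eqToIso hW.symm).op ≪≫ Scheme.ΓSpecIso _

theorem appLE_point [IsIntegral X] (φ : X.functionField →+* M) {U : X.Opens}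
    (hU : genericPoint X ∈ U) {W : (Spec (.of M)).Opens} (hW : W = ⊤)
    (e : W ≤ point X φ ⁻¹ᵁ U) :
    (point X φ).appLE U W e ≫ (fieldSectionsIso hW).hom =
      X.presheaf.germ U _ hU ≫ CommRingCat.ofHom φ := by
  subst hW
  have h1 : (fieldSectionsIso (rfl : (⊤ : (Spec (.of M)).Opens) = ⊤)).hom =
      (Scheme.ΓSpecIso (.of M)).hom := by
    simp [fieldSectionsIso]
  rw [h1]
  have h2 := Scheme.Hom.comp_appLE (Spec.map (CommRingCat.ofHom φ)) (genericMap X) U ⊤ e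
  refine (congrArg (· ≫ (Scheme.ΓSpecIso (.of M)).hom) h2).trans ?_
  rw [Scheme.fromSpecStalk_app hU]
  simp only [Category.assoc]
  change _ ≫ _ ≫ (Spec.map (CommRingCat.ofHom φ)).appTop ≫ _ = _
  rw [Scheme.ΓSpecIso_naturality]
  exact congrArg (X.presheaf.germ U _ hU ≫ ·) (Iso.inv_hom_id_assoc _ _)

theorem preimage_point [IsIntegral X] (φ : X.functionField →+* M) {U : X.Opens}
    (hU : genericPoint X ∈ U) : point X φ ⁻¹ᵁ U = ⊤ := by
  ext t
  simpa [point_apply] using hU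

theorem genericPoint_mem [IrreducibleSpace X] (U : X.Opens) [h : Nonempty U] :
    genericPoint X ∈ U :=
  ((genericPoint_spec X).mem_open_set_iff U.isOpen).mpr (by simpa using h)

/-- The sections of a normal scheme over an affine open subset are integrally closed. -/
theorem isIntegrallyClosed_of_isAffineOpen [IsNormalIntegral X] {U : X.Opens}
    (hU : IsAffineOpen U) [Nonempty U] : IsIntegrallyClosed Γ(X, U) := by
  refine .of_localization_maximal fun P _ hP => ?_
  let t : PrimeSpectrum Γ(X, U) := ⟨P, hP.isPrime⟩
  have ht : hU.fromSpec t ∈ U := by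
    rw [← SetLike.mem_coe, ← hU.range_fromSpec]
    exact ⟨t, rfl⟩
  let := TopCat.Presheaf.algebra_section_stalk X.presheaf ⟨hU.fromSpec t, ht⟩
  have h1 : IsLocalization.AtPrime (X.presheaf.stalk (hU.fromSpec t)) P :=
    hU.isLocalization_stalk' t ht
  have h2 := IsNormalIntegral.normal (hU.fromSpec t)
  exact .of_equiv (IsLocalization.algEquiv P.primeCompl (X.presheaf.stalk (hU.fromSpec t))
    (Localization.AtPrime P)).toRingEquiv

/-- A scheme with an affine open cover by spectra of integrally closed domains is normal. -/
theorem isNormalIntegral_of_forall_exists [IsIntegral X]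
    (h : ∀ x : X, ∃ U : X.Opens, IsAffineOpen U ∧ x ∈ U ∧ IsIntegrallyClosed Γ(X, U)) :
    IsNormalIntegral X := by
  refine ⟨fun x => ?_⟩
  obtain ⟨U, hU, hx, hcl⟩ := h x
  have : Nonempty U := ⟨⟨x, hx⟩⟩
  let := TopCat.Presheaf.algebra_section_stalk X.presheaf ⟨x, hx⟩
  have h1 := hU.isLocalization_stalk ⟨x, hx⟩
  exact isIntegrallyClosed_of_isLocalization (X.presheaf.stalk x)
    (hU.primeIdealOf ⟨x, hx⟩).asIdeal.primeCompl
    (hU.primeIdealOf ⟨x, hx⟩).asIdeal.primeCompl_le_nonZeroDivisors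

/-- An integral birational morphism onto a normal scheme is an isomorphism. -/
theorem isIso_of_surjective_ffMap [IsIntegral X] [IsNormalIntegral Y] (f : X ⟶ Y) [IsDominant f]
    [IsIntegralHom f] (hf : Function.Surjective (ffMap f)) : IsIso f := by
  refine (IsZariskiLocalAtTarget.iff_of_iSup_eq_top (P := .isomorphisms _) _
    (iSup_affineOpens_eq_top Y)).mpr fun U => ?_
  refine (isIso_morphismRestrict_iff_isIso_app _ U.2).mpr ?_
  by_cases hne : Nonempty U.1
  · have hyU : genericPoint Y ∈ U.1 := genericPoint_mem _
    have hxU : genericPoint X ∈ f ⁻¹ᵁ U := by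
      change f (genericPoint X) ∈ U.1
      rw [map_genericPoint f]
      exact hyU
    have : Nonempty (f ⁻¹ᵁ U) := ⟨⟨_, hxU⟩⟩
    have hcomm : f.app U ≫ X.presheaf.germ (f ⁻¹ᵁ U) _ hxU =
        Y.presheaf.germ U _ hyU ≫ ffMap f := by
      rw [ffMap, TopCat.Presheaf.germ_stalkSpecializes_assoc, Scheme.Hom.germ_stalkMap]
    have hc : ∀ a, X.presheaf.germ (f ⁻¹ᵁ U) _ hxU (f.app U a) =
        ffMap f (Y.presheaf.germ U _ hyU a) := fun a => ConcreteCategory.congr_hom hcomm a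
    have hinjX := germ_injective_of_isIntegral (X := X) _ hxU
    have hinjY := germ_injective_of_isIntegral (X := Y) _ hyU
    have hcl := isIntegrallyClosed_of_isAffineOpen U.2
    have := functionField_isFractionRing_of_isAffineOpen Y U U.2
    rw [ConcreteCategory.isIso_iff_bijective]
    refine ⟨fun a b hab => hinjY ((ffMap f).hom.injective ?_), fun b => ?_⟩
    · have := congrArg (X.presheaf.germ (f ⁻¹ᵁ U) _ hxU) hab
      rwa [hc, hc] at this
    · obtain ⟨c, hcb⟩ := hf (X.presheaf.germ (f ⁻¹ᵁ U) _ hxU b)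
      -- An integral equation of the section b is pulled back along the injective map of function
      -- fields; normality of `Y` then puts c in Γ(Y, U).
      have hint : IsIntegral Γ(Y, U) c := by
        obtain ⟨p, hp, hpb⟩ := f.isIntegral_app U.1 U.2 b
        refine ⟨p, hp, (ffMap f).hom.injective ?_⟩
        rw [map_zero, Polynomial.hom_eval₂]
        have := congrArg (X.presheaf.germ (f ⁻¹ᵁ U) _ hxU) hpb
        rw [map_zero] at this
        erw [Polynomial.hom_eval₂] at this
        rw [← this]
        erw [hcb]
        congr 1
        exact congrArg CommRingCat.Hom.hom hcomm.symm
      obtain ⟨a, rfl⟩ := IsIntegrallyClosed.isIntegral_iff.mp hint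
      refine ⟨a, hinjX ?_⟩
      rw [hc, ← hcb]
      rfl
  · have hU : U.1 = ⊥ := by
      ext x
      simpa using fun hx => hne ⟨⟨x, hx⟩⟩
    have h1 : Subsingleton Γ(Y, U.1) := by rw [hU]; infer_instance
    have h2 : Subsingleton Γ(X, f ⁻¹ᵁ U.1) := by
      have : f ⁻¹ᵁ U.1 = ⊥ := by rw [hU]; rfl
      rw [this]; infer_instance
    rw [ConcreteCategory.isIso_iff_bijective]
    exact ⟨fun _ _ _ => Subsingleton.elim _ _, fun b => ⟨0, Subsingleton.elim _ _⟩⟩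

/-- Over an affine open set the relative normalization is the integral closure in the sections of
Spec M, which are M. The last clause records how the isomorphism is induced by `toNormalization`, as
needed to compute function fields. -/
theorem exists_equiv_integralClosure [IsIntegral X] [QuasiSeparatedSpace X]
    (φ : X.functionField →+* M) {U : X.Opens} (hU : IsAffineOpen U) (hη : genericPoint X ∈ U) :
    letI : Algebra Γ(X, U) M := (φ.comp (X.presheaf.germ U _ hη).hom).toAlgebra
    ∃ e : Γ((point X φ).normalization, (point X φ).fromNormalization ⁻¹ᵁ U) ≃+*
        integralClosure Γ(X, U) M,
      (∀ a, e ((point X φ).fromNormalization.app U a) = algebraMap _ _ a) ∧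
      ∀ b, (e b : M) = (fieldSectionsIso (preimage_point φ hη)).hom
        ((point X φ).toNormalization.appLE ((point X φ).fromNormalization ⁻¹ᵁ U)
          (point X φ ⁻¹ᵁ U) (by simp [← Scheme.Hom.comp_preimage]) b) := by
  let : Algebra Γ(X, U) M := (φ.comp (X.presheaf.germ U _ hη).hom).toAlgebra
  let : Algebra Γ(X, U) Γ(Spec (.of M), point X φ ⁻¹ᵁ U) := ((point X φ).app U).hom.toAlgebra
  let i := fieldSectionsIso (preimage_point φ hη)
  let e₁ : Γ(Spec (.of M), point X φ ⁻¹ᵁ U) ≃ₐ[Γ(X, U)] M :=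
    AlgEquiv.ofRingEquiv (f := i.commRingCatIsoToRingEquiv) fun a => by
      have h := appLE_point φ hη (preimage_point φ hη) le_rfl
      rw [← Scheme.Hom.app_eq_appLE] at h
      exact ConcreteCategory.congr_hom h a
  let e₀ := ((point X φ).normalizationObjIso hU).commRingCatIsoToRingEquiv
  refine ⟨e₀.trans e₁.mapIntegralClosure.toRingEquiv, fun a => ?_, fun b => ?_⟩
  · have h1 : e₀ ((point X φ).fromNormalization.app U a) =
        algebraMap _ (integralClosure Γ(X, U) Γ(Spec (.of M), point X φ ⁻¹ᵁ U)) a := by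
      have h := (point X φ).fromNormalization_app hU
      exact ConcreteCategory.congr_hom ((Iso.eq_comp_inv _).mp h) a
    rw [RingEquiv.trans_apply, h1]
    exact e₁.mapIntegralClosure.commutes a
  · have h := (point X φ).normalizationObjIso_hom_val hU
    rw [← h]
    rfl

/-- Normalization in a finite extension of the function field is finite. -/
theorem isFinite_fromNormalization [IsNormalIntegral X] [IsLocallyNoetherian X]
    [CharZero X.functionField] (φ : X.functionField →+* M) (hφ : φ.Finite) :
    IsFinite (point X φ).fromNormalization := by
  refine ⟨fun U hU => ?_⟩
  by_cases hne : Nonempty U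
  · have hη := genericPoint_mem U
    let : Algebra Γ(X, U) M := (φ.comp (X.presheaf.germ U _ hη).hom).toAlgebra
    let := φ.toAlgebra
    have : IsScalarTower Γ(X, U) X.functionField M := .of_algebraMap_eq' rfl
    have : FiniteDimensional X.functionField M := hφ
    have := functionField_isFractionRing_of_isAffineOpen X U hU
    have := isIntegrallyClosed_of_isAffineOpen hU
    have : IsNoetherianRing Γ(X, U) := IsLocallyNoetherian.component_noetherian ⟨U, hU⟩
    -- Characteristic zero makes the extension separable, so the integral closure of the noetherian
    -- integrally closed ring is finite.
    have hfin := IsIntegralClosure.finite Γ(X, U) X.functionField M (integralClosure Γ(X, U) M)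
    obtain ⟨e, he, -⟩ := exists_equiv_integralClosure φ hU hη
    have hcomp : ((point X φ).fromNormalization.app U).hom =
        (e.symm : _ →+* _).comp (algebraMap Γ(X, U) (integralClosure Γ(X, U) M)) := by
      ext a
      exact (e.symm_apply_eq.mpr (he a).symm).symm
    rw [hcomp]
    exact RingHom.Finite.comp (.of_surjective _ e.symm.surjective)
      (RingHom.finite_algebraMap.mpr hfin)
  · have hU : U = ⊥ := by
      ext x
      simpa using fun hx => hne ⟨⟨x, hx⟩⟩
    have h2 : Subsingleton Γ((point X φ).normalization,
        (point X φ).fromNormalization ⁻¹ᵁ U) := by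
      have : (point X φ).fromNormalization ⁻¹ᵁ U = ⊥ := by rw [hU]; rfl
      rw [this]; infer_instance
    exact .of_surjective _ fun b => ⟨0, Subsingleton.elim _ _⟩

theorem isNormalIntegral_normalization [IsIntegral X] [QuasiSeparatedSpace X]
    (φ : X.functionField →+* M) (hφ : φ.Finite) :
    IsNormalIntegral (point X φ).normalization := by
  refine isNormalIntegral_of_forall_exists fun z => ?_
  obtain ⟨_, ⟨U, hU, rfl⟩, hzU, -⟩ := X.isBasis_affineOpens.exists_subset_of_mem_open
    (Set.mem_univ ((point X φ).fromNormalization z)) isOpen_univ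
  refine ⟨(point X φ).fromNormalization ⁻¹ᵁ U, hU.preimage _, hzU, ?_⟩
  have : Nonempty U := ⟨⟨_, hzU⟩⟩
  have hη := genericPoint_mem U
  let : Algebra Γ(X, U) M := (φ.comp (X.presheaf.germ U _ hη).hom).toAlgebra
  obtain ⟨e, -⟩ := exists_equiv_integralClosure φ hU hη
  let := φ.toAlgebra
  have : IsScalarTower Γ(X, U) X.functionField M := .of_algebraMap_eq' rfl
  have : FiniteDimensional X.functionField M := hφ
  have := functionField_isFractionRing_of_isAffineOpen X U hU
  have := integralClosure.isIntegrallyClosedOfFiniteExtension (R := Γ(X, U)) X.functionField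
    (L := M)
  exact .of_equiv e.symm

instance isDominant_point [IsIntegral X] (φ : X.functionField →+* M) : IsDominant (point X φ) := by
  refine ⟨fun x => ?_⟩
  obtain ⟨t⟩ : Nonempty (Spec (.of M)) := inferInstanceAs (Nonempty (PrimeSpectrum M))
  have h : point X φ t ⤳ x := by
    rw [point_apply]
    exact genericPoint_specializes x
  exact h.mem_closed isClosed_closure (subset_closure ⟨t, rfl⟩)

instance isDominant_fromNormalization [IsIntegral X] [QuasiSeparatedSpace X]
    (φ : X.functionField →+* M) : IsDominant (point X φ).fromNormalization := by
  have : IsDominant ((point X φ).toNormalization ≫ (point X φ).fromNormalization) := by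
    rw [Scheme.Hom.toNormalization_fromNormalization]
    infer_instance
  exact .of_comp (point X φ).toNormalization _

/-- The function field of the normalization in a finite extension `M` of the function field
is `M`. -/
theorem exists_toNormalization_eq [IsNormalIntegral X] [IsLocallyNoetherian X]
    [CharZero X.functionField] (φ : X.functionField →+* M) (hφ : φ.Finite) :
    ∃ ψ : (point X φ).normalization.functionField →+* M,
      (point X φ).toNormalization = point _ ψ ∧
      ψ.comp (ffMap (point X φ).fromNormalization).hom = φ ∧ Function.Surjective ψ := by
  have := isFinite_fromNormalization φ hφ
  obtain ⟨ψ, hψ, hψφ⟩ := exists_eq_point_of_comp (point X φ).fromNormalization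
    (Scheme.Hom.toNormalization_fromNormalization (point X φ))
  refine ⟨ψ, hψ, hψφ, ?_⟩
  obtain ⟨_, ⟨U, hU, rfl⟩, hη, -⟩ := X.isBasis_affineOpens.exists_subset_of_mem_open
    (Set.mem_univ (genericPoint X)) isOpen_univ
  have : Nonempty U := ⟨⟨_, hη⟩⟩
  let : Algebra Γ(X, U) M := (φ.comp (X.presheaf.germ U _ hη).hom).toAlgebra
  let := φ.toAlgebra
  have : IsScalarTower Γ(X, U) X.functionField M := .of_algebraMap_eq' rfl
  have : FiniteDimensional X.functionField M := hφ
  have := functionField_isFractionRing_of_isAffineOpen X U hU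
  have hη' : genericPoint (point X φ).normalization ∈ (point X φ).fromNormalization ⁻¹ᵁ U := by
    change (point X φ).fromNormalization _ ∈ U
    rw [map_genericPoint]
    exact hη
  -- Elements of the integral closure come from germs of sections of the normalization, and their
  -- fractions fill M.
  have hmem : ∀ b : integralClosure Γ(X, U) M, (b : M) ∈ ψ.fieldRange := by
    obtain ⟨e, -, he⟩ := exists_equiv_integralClosure φ hU hη
    intro b
    obtain ⟨c, rfl⟩ := e.surjective b
    refine ⟨(point X φ).normalization.presheaf.germ _ _ hη' c, ?_⟩
    have h := appLE_point ψ hη' (preimage_point φ hη)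
      (by rw [← hψ, ← Scheme.Hom.comp_preimage, Scheme.Hom.toNormalization_fromNormalization])
    rw [he]
    simp only [hψ]
    exact (ConcreteCategory.congr_hom h c).symm
  have := integralClosure.isFractionRing_of_finite_extension (A := Γ(X, U)) X.functionField M
  intro m
  obtain ⟨a, b, -, rfl⟩ := IsFractionRing.div_surjective (A := integralClosure Γ(X, U) M) m
  exact RingHom.mem_fieldRange.mp (div_mem (hmem a) (hmem b))

/-- A finite dominant morphism `f` from a normal scheme factors through the normalization of its
target in any intermediate field. -/
theorem exists_factorization [IsNormalIntegral X] [IsNormalIntegral Y] [IsLocallyNoetherian Y]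
    [CharZero Y.functionField] (f : X ⟶ Y) [IsFinite f] [IsDominant f]
    (K : Subfield X.functionField) (hK : (ffMap f).hom.fieldRange ≤ K) :
    ∃ (Z : Scheme.{u}) (_ : IsNormalIntegral Z) (h : X ⟶ Z) (g : Z ⟶ Y) (_ : IsFinite h)
      (_ : IsDominant h) (_ : IsFinite g) (_ : IsDominant g),
      h ≫ g = f ∧ (ffMap h).hom.fieldRange = K := by
  let i : Y.functionField →+* K := (ffMap f).hom.codRestrict K fun a => hK ⟨a, rfl⟩
  have hf : (ffMap f).hom.Finite := ffMap_finite f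
  have hi : i.Finite := by
    algebraize [i, (ffMap f).hom]
    have : IsScalarTower Y.functionField K X.functionField := .of_algebraMap_eq' rfl
    have : Module.Finite Y.functionField X.functionField := hf
    exact (Module.Finite.of_injective (IsScalarTower.toAlgHom Y.functionField K
      X.functionField).toLinearMap Subtype.val_injective : Module.Finite Y.functionField K)
  obtain ⟨ψ, hψ, hψi, hψs⟩ := exists_toNormalization_eq i hi
  obtain ⟨θ, hθ, -, hθs⟩ := exists_toNormalization_eq (ffMap f).hom hf
  have := isFinite_fromNormalization i hi
  have := isFinite_fromNormalization _ hf
  have := isNormalIntegral_normalization i hi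
  have hpf : point Y (ffMap f).hom = genericMap X ≫ f := (genericMap_comp f).symm
  have hpg : point Y (ffMap f).hom =
      (Spec.map (CommRingCat.ofHom K.subtype) ≫ (point Y i).toNormalization) ≫
        (point Y i).fromNormalization := by
    rw [Category.assoc, Scheme.Hom.toNormalization_fromNormalization, SpecMap_comp_point]
    rfl
  have hid : point X (RingHom.id X.functionField) = genericMap X := by
    rw [point]
    exact (congrArg (· ≫ genericMap X) (Spec.map_id _)).trans (Category.id_comp _)
  have hdom : IsDominant (genericMap X) := hid ▸ isDominant_point _
  -- the normalization of `Y` in the function field of `X` is `X`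
  let d := (point Y (ffMap f).hom).normalizationDesc (genericMap X) f hpf
  have hd1 : (point Y (ffMap f).hom).toNormalization ≫ d = genericMap X :=
    Scheme.Hom.toNormalization_normalizationDesc _ _ _ hpf
  have hd2 : d ≫ f = (point Y (ffMap f).hom).fromNormalization :=
    Scheme.Hom.normalizationDesc_comp _ _ _ hpf
  have : IsDominant ((point Y (ffMap f).hom).toNormalization ≫ d) := by rwa [hd1]
  have : IsDominant d := .of_comp (point Y (ffMap f).hom).toNormalization d
  -- θ is an injective left inverse of the map of function fields of d, so d is birational; being
  -- integral onto the normal scheme `X`, it is an isomorphism.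
  have : IsIso d := by
    refine isIso_of_surjective_ffMap d fun a => ⟨θ a, θ.injective ?_⟩
    have h1 : θ.comp (ffMap d).hom = RingHom.id _ := point_injective (by
      rw [← point_comp, ← hθ, hd1, hid])
    exact RingHom.congr_fun h1 (θ a)
  -- The universal property of the normalization in the larger field K(X) gives a map to the
  -- normalization in `K`; composed with the inverse of d it is the required map from `X`.
  let d' := (point Y (ffMap f).hom).normalizationDesc _ (point Y i).fromNormalization hpg
  have hd1' : (point Y (ffMap f).hom).toNormalization ≫ d' =
      Spec.map (CommRingCat.ofHom K.subtype) ≫ (point Y i).toNormalization :=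
    Scheme.Hom.toNormalization_normalizationDesc _ _ _ hpg
  have hd2' : d' ≫ (point Y i).fromNormalization = (point Y (ffMap f).hom).fromNormalization :=
    Scheme.Hom.normalizationDesc_comp _ _ _ hpg
  have hcomp : (inv d ≫ d') ≫ (point Y i).fromNormalization = f := by
    rw [Category.assoc, hd2', ← hd2, IsIso.inv_hom_id_assoc]
  have hgen : genericMap X ≫ inv d ≫ d' = point _ (K.subtype.comp ψ) := by
    rw [← hd1, Category.assoc, IsIso.hom_inv_id_assoc, hd1', hψ, SpecMap_comp_point]
  have : IsDominant (genericMap X ≫ inv d ≫ d') := hgen ▸ isDominant_point _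
  have hdom' : IsDominant (inv d ≫ d') := .of_comp (genericMap X) _
  have : IsFinite ((inv d ≫ d') ≫ (point Y i).fromNormalization) := by rwa [hcomp]
  have hfin : IsFinite (inv d ≫ d') := .of_comp _ (point Y i).fromNormalization
  refine ⟨_, inferInstance, inv d ≫ d', (point Y i).fromNormalization, hfin, hdom', inferInstance,
    inferInstance, hcomp, ?_⟩
  have hff : ffMap (inv d ≫ d') = CommRingCat.ofHom (K.subtype.comp ψ) :=
    (ffMap_eq_iff _).mpr hgen
  rw [hff]
  ext a
  constructor
  · rintro ⟨b, rfl⟩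
    exact (ψ b).2
  · intro ha
    obtain ⟨b, hb⟩ := hψs ⟨a, ha⟩
    exact ⟨b, congrArg Subtype.val hb⟩

end Normalization

/-! ### Monodromy groups as Galois groups -/

section Monodromy

variable {X Y X₀ : Scheme.{u}} {Ω : Type u} [Field Ω]

variable (Ω) in
/-- Automorphisms of a field act on its spectrum. -/
def specAut : RingAut Ω →* Aut (Spec (.of Ω)) where
  toFun σ :=
    { hom := Spec.map (CommRingCat.ofHom (σ.symm : Ω →+* Ω))
      inv := Spec.map (CommRingCat.ofHom (σ : Ω →+* Ω))
      hom_inv_id := by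
        rw [← Spec.map_comp, ← CommRingCat.ofHom_comp, RingEquiv.symm_comp]
        exact Spec.map_id _
      inv_hom_id := by
        rw [← Spec.map_comp, ← CommRingCat.ofHom_comp, RingEquiv.comp_symm]
        exact Spec.map_id _ }
  map_one' := Iso.ext (Spec.map_id _)
  map_mul' σ τ := by
    refine Iso.ext ?_
    exact Spec.map_comp (CommRingCat.ofHom (σ.symm : Ω →+* Ω))
      (CommRingCat.ofHom (τ.symm : Ω →+* Ω))

theorem specAut_inv (σ : RingAut Ω) :
    (specAut Ω σ).inv = Spec.map (CommRingCat.ofHom (σ : Ω →+* Ω)) := rfl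

theorem specAut_bijective : Function.Bijective (specAut Ω) := by
  refine ⟨fun σ τ h => ?_, fun t => ?_⟩
  · have h1 := Spec.map_injective (congrArg Iso.inv h)
    exact RingEquiv.ext fun a => RingHom.congr_fun (congrArg CommRingCat.Hom.hom h1) a
  · obtain ⟨s, hs⟩ := Spec.map_surjective t.inv
    obtain ⟨r, hr⟩ := Spec.map_surjective t.hom
    have h1 : s ≫ r = 𝟙 _ := Spec.map_injective (by
      rw [Spec.map_comp, hs, hr, Spec.map_id, t.hom_inv_id])
    have h2 : r ≫ s = 𝟙 _ := Spec.map_injective (by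
      rw [Spec.map_comp, hs, hr, Spec.map_id, t.inv_hom_id])
    refine ⟨RingEquiv.ofRingHom s.hom r.hom (congrArg CommRingCat.Hom.hom h2)
      (congrArg CommRingCat.Hom.hom h1), ?_⟩
    exact Iso.ext hr

theorem specAut_mem_ptAut_iff [IsIntegral X] {x : Spec (.of Ω) ⟶ X} {ζ : X.functionField →+* Ω}
    (hx : x = point X ζ) {σ : RingAut Ω} : specAut Ω σ ∈ ptAut x ↔ σ ∈ galGroup ζ := by
  change (specAut Ω σ).inv ≫ x = x ↔ _
  rw [hx, specAut_inv, SpecMap_comp_point, point_injective.eq_iff]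
  exact RingHom.ext_iff

/-- The automorphisms over a geometric generic point form the absolute Galois group of the
function field. -/
def ptAutEquiv [IsIntegral X] {x : Spec (.of Ω) ⟶ X} {ζ : X.functionField →+* Ω}
    (hx : x = point X ζ) : galGroup ζ ≃* ptAut x :=
  MulEquiv.ofBijective
    (((specAut Ω).comp (galGroup ζ).subtype).codRestrict (ptAut x) fun σ =>
      (specAut_mem_ptAut_iff hx).mpr σ.2)
    ⟨fun σ τ h => Subtype.ext (specAut_bijective.1 (congrArg Subtype.val h)), fun t => by
      obtain ⟨σ, hσ⟩ := specAut_bijective.2 t.1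
      exact ⟨⟨σ, (specAut_mem_ptAut_iff hx).mp (hσ ▸ t.2)⟩, Subtype.ext hσ⟩⟩

theorem ptAutEquiv_apply [IsIntegral X] {x : Spec (.of Ω) ⟶ X} {ζ : X.functionField →+* Ω}
    (hx : x = point X ζ) (σ : galGroup ζ) : (ptAutEquiv hx σ).1 = specAut Ω σ.1 := rfl

theorem ptAut_le {T : Scheme.{u}} (y : T ⟶ Y) (g : Y ⟶ X₀) : ptAut y ≤ ptAut (y ≫ g) := by
  intro t ht
  have h1 : t.inv ≫ y = y := ht
  change t.inv ≫ y ≫ g = y ≫ g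
  rw [← Category.assoc, h1]

theorem fibAction_apply {T : Scheme.{u}} (f : X ⟶ X₀) (x : T ⟶ X₀) (t : ptAut x) (p : Fib f x) :
    (fibAction f x t p).1 = t.1.inv ≫ p.1 := rfl

theorem fibAction_eq_self_iff {T : Scheme.{u}} {f : X ⟶ X₀} {x : T ⟶ X₀} {t : ptAut x}
    {p : Fib f x} : fibAction f x t p = p ↔ t.1 ∈ ptAut p.1 :=
  Subtype.ext_iff

theorem fibAction_ptAutEquiv_eq_self_iff [IsIntegral X] [IsIntegral X₀] {f : X ⟶ X₀}
    {x : Spec (.of Ω) ⟶ X₀} {ζ : X₀.functionField →+* Ω} (hx : x = point X₀ ζ)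
    {σ : galGroup ζ} {p : Fib f x} {φ : X.functionField →+* Ω} (hp : p.1 = point X φ) :
    fibAction f x (ptAutEquiv hx σ) p = p ↔ σ.1 ∈ galGroup φ :=
  fibAction_eq_self_iff.trans (specAut_mem_ptAut_iff hp)

theorem finite_fib [IsIntegral X] [IsIntegral X₀] (f : X ⟶ X₀) [IsFinite f] [IsDominant f]
    {x : Spec (.of Ω) ⟶ X₀} {ζ : X₀.functionField →+* Ω} (hx : x = point X₀ ζ) :
    Finite (Fib f x) := by
  have := finite_emb (ffMap f).hom (ffMap_finite f) ζ
  refine Finite.of_surjective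
    (fun φ : Emb (ffMap f).hom ζ => (⟨point X φ.1, by rw [point_comp, φ.2, hx]⟩ : Fib f x)) ?_
  intro p
  obtain ⟨φ, hφ, hφζ⟩ := exists_eq_point_of_comp f (p.2.trans hx)
  exact ⟨⟨φ, hφζ⟩, Subtype.ext hφ.symm⟩

theorem fibAction_transitive [IsAlgClosed Ω] [IsIntegral X] [IsIntegral X₀] (f : X ⟶ X₀)
    [IsFinite f] [IsDominant f] {x : Spec (.of Ω) ⟶ X₀} {ζ : X₀.functionField →+* Ω}
    (hx : x = point X₀ ζ) (hζ : ζ.IsIntegral) (p q : Fib f x) :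
    ∃ σ, fibAction f x (ptAutEquiv hx σ) p = q := by
  obtain ⟨φ, hφ, hφζ⟩ := exists_eq_point_of_comp f (p.2.trans hx)
  obtain ⟨θ, hθ, hθζ⟩ := exists_eq_point_of_comp f (q.2.trans hx)
  obtain ⟨σ, hσ⟩ := embAction_transitive (ffMap f).hom ζ hζ ⟨φ, hφζ⟩ ⟨θ, hθζ⟩
  refine ⟨σ, Subtype.ext ?_⟩
  rw [fibAction_apply, ptAutEquiv_apply, specAut_inv, hφ, hθ, SpecMap_comp_point]
  exact congrArg (point X) (congrArg Subtype.val hσ)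

/-- The kernel attached to a decomposition of maps of normal schemes is large. -/
theorem isLarge_monKerPi [IsAlgClosed Ω] [IsNormalIntegral X] [IsNormalIntegral Y]
    [IsNormalIntegral X₀] [IsLocallyNoetherian X₀] [CharZero X₀.functionField]
    (h : X ⟶ Y) (g : Y ⟶ X₀) [IsFinite h] [IsDominant h] [IsFinite g] [IsDominant g]
    (ψ : Y.functionField →+* Ω) (hψ : ψ.IsIntegral) {y : Spec (.of Ω) ⟶ Y} (hy : y = point Y ψ)
    (hinv : IsInvariantDecomp h g)
    (hsoc : SocleNonabelianMinimalNormal (monodromyGroup h y))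
    (hcc : IsConjCompatible (fun j : Fib g (y ≫ g) => monodromyGroup h j.1)
      (monKerPi h g (y ≫ g)))
    (hZ : ∀ (Z : Scheme.{u}) [IsNormalIntegral Z] (g₂ : Y ⟶ Z) (g₁ : Z ⟶ X₀)
      [IsFinite g₂] [IsDominant g₂] [IsFinite g₁] [IsDominant g₁],
      g₂ ≫ g₁ = g → 1 < degree g₂ →
      IsGaloisProper h g₂ (y ≫ g₂) ∧
        ¬ EmbedsIn (monodromyGroup (h ≫ g₂) (y ≫ g₂)) (MulAut (socle (monodromyGroup h y)))) :
    IsLarge (fun j : Fib g (y ≫ g) => monodromyGroup h j.1) (monKerPi h g (y ≫ g)) := by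
  set x := y ≫ g with hx
  set ζ := ψ.comp (ffMap g).hom with hζ
  have hxζ : x = point X₀ ζ := by rw [hx, hy, point_comp]
  have hgfin := ffMap_finite g
  have hζi : ζ.IsIntegral := RingHom.IsIntegral.trans _ _ hgfin.to_isIntegral hψ
  have hhfin := ffMap_finite h
  obtain ⟨α, hα⟩ := exists_extension (ffMap h).hom hhfin.to_isIntegral ψ
  have hff : (ffMap (h ≫ g)).hom = (ffMap h).hom.comp (ffMap g).hom := by rw [ffMap_comp]; rfl
  have hαx : α.comp ((ffMap h).hom.comp (ffMap g).hom) = ζ := by rw [← RingHom.comp_assoc, hα]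
  have hαy : point X α ≫ h = y := by rw [point_comp, hα, hy]
  have := finite_fib g hxζ
  have := finite_fib (h ≫ g) hxζ
  let ε := ptAutEquiv hxζ
  let αp : Fib (h ≫ g) x := ⟨point X α, by rw [← Category.assoc, hαy]⟩
  let j₀ : Fib g x := ⟨y, rfl⟩
  have hfixα : ∀ σ, fibAction (h ≫ g) x (ε σ) αp = αp ↔ σ.1 ∈ galGroup α := fun σ =>
    fibAction_ptAutEquiv_eq_self_iff hxζ rfl
  have hfixy : ∀ σ, fibAction g x (ε σ) j₀ = j₀ ↔ σ.1 ∈ galGroup ψ := fun σ =>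
    fibAction_ptAutEquiv_eq_self_iff hxζ hy
  have hsur : ∀ {Z : Scheme.{u}} [IsIntegral Z] (f : X ⟶ Z) [IsFinite f] [IsDominant f],
      1 < degree f ↔ (ffMap f).hom.fieldRange ≠ ⊤ := fun f _ _ => by
    rw [one_lt_degree_iff, Ne, RingHom.fieldRange_eq_top_iff]
  refine isLarge_of_blocks (fibEquiv h g x) (fun j => monodromyGroup h j.1)
    ((fibAction (h ≫ g) x).comp ε.toMonoidHom) ((fibAction g x).comp ε.toMonoidHom)
    (fun γ p => Subtype.ext (Category.assoc _ _ _))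
    (fibAction_transitive _ hxζ hζi) (fibAction_transitive _ hxζ hζi) ?_ ?_ _ ?_
    j₀ αp (Subtype.ext hαy) ?_ hsoc hcc ?_ ?_
  · intro j γ hγ
    exact ⟨⟨fibAction h j.1 ⟨(ε γ).1, fibAction_eq_self_iff.mp hγ⟩, ⟨_, rfl⟩⟩, fun β => rfl⟩
  · rintro j ⟨_, t, rfl⟩
    have ht : t.1 ∈ ptAut x := (congrArg ptAut j.2).le (ptAut_le j.1 g t.2)
    obtain ⟨γ, hγ⟩ := ε.surjective ⟨t.1, ht⟩
    have hγt : (ε γ).1 = t.1 := congrArg Subtype.val hγ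
    refine ⟨γ, fibAction_eq_self_iff.mpr (hγt ▸ t.2), fun β => Subtype.ext ?_⟩
    change (ε γ).1.inv ≫ β.1 = t.1.inv ≫ β.1
    rw [hγt]
  · intro w
    constructor
    · rintro ⟨t, ht, hw⟩
      obtain ⟨γ, rfl⟩ := ε.surjective t
      exact ⟨γ, ht, hw⟩
    · rintro ⟨γ, hγ, hw⟩
      exact ⟨ε γ, hγ, hw⟩
  · intro H h1 h2
    -- An intermediate field is realized as the function field of a normal scheme through which h ≫
    -- g factors; the function field of the common factor W is the required proper subfield.
    have hinvM : ∀ M : Subfield X.functionField,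
        ((ffMap h).hom.comp (ffMap g).hom).fieldRange ≤ M → M ≠ ⊤ →
        ∃ M' : Subfield X.functionField, M ≤ M' ∧ (ffMap h).hom.fieldRange ≤ M' ∧ M' ≠ ⊤ := by
      intro M hM hne
      obtain ⟨Z, _, h₁, g₁, _, _, _, _, hc, hr⟩ := exists_factorization (h ≫ g) M (hff ▸ hM)
      obtain ⟨W, _, w, a, b, _, _, _, _, _, _, rfl, rfl, hw⟩ := hinv Z h₁ g₁ hc
        ((hsur h₁).mpr (hr ▸ hne))
      refine ⟨(ffMap w).hom.fieldRange, ?_, ?_, (hsur w).mp hw⟩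
      · rw [← hr, ffMap_comp]
        rintro _ ⟨c, rfl⟩
        exact ⟨_, rfl⟩
      · rw [ffMap_comp]
        rintro _ ⟨c, rfl⟩
        exact ⟨_, rfl⟩
    obtain ⟨σ, ⟨τ, hτ, rfl⟩, hσ1, hσ2⟩ := exists_mem_of_invariant (ffMap g).hom (ffMap h).hom
      (hhfin.comp hgfin) α (hαx ▸ hζi) hinvM
      (H := H.map (galGroup ζ).subtype)
      (fun σ hσ => ⟨⟨σ, fun a => by rw [← hαx]; exact hσ _⟩, h1 _ ((hfixα _).mpr hσ), rfl⟩)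
      (by rw [hαx]; exact Subgroup.map_subtype_le H)
      (by
        obtain ⟨γ, hγ, hγα⟩ := h2
        exact ⟨γ, ⟨γ, hγ, rfl⟩, fun h0 => hγα ((hfixα γ).mpr h0)⟩)
    refine ⟨τ, hτ, (hfixy τ).mpr ?_, fun h0 => hσ2 ((hfixα τ).mp h0)⟩
    rw [hα] at hσ1
    exact hσ1
  · rintro ⟨j, hj⟩
    -- If g were birational, a point of its fibre would be determined by its image, so `j` would be
    -- the base point y.
    have hdeg : 1 < degree g := by
      rw [one_lt_degree_iff]
      intro hs
      obtain ⟨θ, hθ, hθζ⟩ := exists_eq_point_of_comp g (j.2.trans hxζ)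
      refine hj (Subtype.ext ?_)
      change j.1 = y
      rw [hθ, hy]
      refine congrArg _ (RingHom.ext fun a => ?_)
      obtain ⟨b, rfl⟩ := hs a
      exact RingHom.congr_fun hθζ b
    -- Galois-properness is applied to the trivial decomposition of g, with Z = X₀.
    have hne := (hZ X₀ g (𝟙 X₀) (Category.comp_id g) hdeg).1.2.2
    obtain ⟨⟨_, t, ht, rfl⟩, hne⟩ := Subgroup.ne_bot_iff_exists_ne_one.mp hne
    obtain ⟨γ, rfl⟩ := ε.surjective t
    exact ⟨γ, ht, fun h0 => hne (Subtype.ext h0)⟩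
  · intro H h1 h2 φ hφ
    set H' : Subgroup (RingAut Ω) := H.map (galGroup ζ).subtype with hH'
    have hH1 : galGroup ψ ≤ H' := fun σ hσ =>
      ⟨⟨σ, fun a => hσ (ffMap g a)⟩, h1 _ ((hfixy _).mpr hσ), rfl⟩
    have hH2 : H' ≤ galGroup ζ := Subgroup.map_subtype_le H
    have hcorr := galGroup_fixedSubfield (ffMap g).hom hgfin ψ hζi hH1 hH2
    set M := fixedSubfield ψ H' with hM
    have hMne : M ≠ ⊤ := by
      intro h0
      obtain ⟨γ, hγ, hγy⟩ := h2
      refine hγy ((hfixy γ).mpr fun a => ?_)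
      have : a ∈ M := h0 ▸ Subfield.mem_top a
      exact this γ ⟨γ, hγ, rfl⟩
    obtain ⟨Z, _, g₂, g₁, _, _, _, _, hc, hr⟩ :=
      exists_factorization g M (fieldRange_le_fixedSubfield (ffMap g).hom ψ hH2)
    have hdeg : 1 < degree g₂ := by
      rw [one_lt_degree_iff]
      intro hs
      exact hMne (hr ▸ RingHom.fieldRange_eq_top_iff.mpr hs)
    have hcorr' : galGroup (ψ.comp (ffMap g₂).hom) = H' := by
      rw [← hcorr]
      ext σ
      constructor
      · rintro hσ ⟨_, hm⟩
        obtain ⟨b, rfl⟩ := hr.ge hm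
        exact hσ b
      · intro hσ b
        exact hσ ⟨_, hr.le ⟨b, rfl⟩⟩
    have hx' : y ≫ g₂ = point Z (ψ.comp (ffMap g₂).hom) := by rw [hy, point_comp]
    refine (hZ Z g₂ g₁ hc hdeg).2 ?_
    -- The fixed field of `H` is the function field of Z, so `H` is the group of automorphisms over
    -- the geometric point of Z, and the orbit of α is the fibre of h ≫ g₂.
    let η : H ≃* ptAut (y ≫ g₂) :=
      ((H.equivMapOfInjective _ (galGroup ζ).subtype_injective).trans
        (MulEquiv.subgroupCongr hcorr'.symm)).trans (ptAutEquiv hx')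
    have hη : ∀ γ : H, (η γ).1 = (ε γ.1).1 := fun γ => rfl
    refine embedsIn_range _ (φ.comp η.symm.toMonoidHom) fun t => ?_
    obtain ⟨γ, rfl⟩ := η.surjective t
    have hφη : (φ.comp η.symm.toMonoidHom) (η γ) = φ γ := by simp
    rw [hφη, hφ]
    let q₀ : Fib (h ≫ g₂) (y ≫ g₂) := ⟨point X α, by rw [← Category.assoc, hαy]⟩
    constructor
    · intro hγ δ hδ
      have h3 := congrArg Subtype.val
        (Equiv.congr_fun hγ (fibAction (h ≫ g₂) (y ≫ g₂) (η ⟨δ, hδ⟩) q₀))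
      exact Subtype.ext h3
    · intro hγ
      refine Equiv.ext fun p => Subtype.ext ?_
      have hint : (ψ.comp (ffMap g₂).hom).IsIntegral :=
        RingHom.IsIntegral.trans _ _ (ffMap_finite g₂).to_isIntegral hψ
      obtain ⟨δ, hδ⟩ := fibAction_transitive (h ≫ g₂) hx' hint q₀ p
      obtain ⟨δ, hδ'⟩ := η.surjective (ptAutEquiv hx' δ)
      rw [← hδ'] at hδ
      have h3 := congrArg Subtype.val (hγ δ δ.2)
      rw [← hδ]
      exact h3

end Monodromy

end MonDec

end

/-! ### The theorem for varieties and for fields -/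

open MonDec

theorem theorem4p1 (F : Type u) [Field F] [CharZero F] :
    -- maps of varieties over `F`
    (∀ (X Y X₀ : Scheme.{u}) [IsNormalIntegral X] [IsNormalIntegral Y] [IsNormalIntegral X₀]
      (s : X₀ ⟶ Spec (.of F)) [LocallyOfFiniteType s] [QuasiCompact s] [IsSeparated s]
      (h : X ⟶ Y) (g : Y ⟶ X₀) [IsFinite h] [IsDominant h] [IsFinite g] [IsDominant g],
      letI y := geomGenericPoint Y
      IsInvariantDecomp h g →
      SocleNonabelianMinimalNormal (monodromyGroup h y) →
      IsConjCompatible (fun j : Fib g (y ≫ g) => monodromyGroup h j.1) (monKerPi h g (y ≫ g)) →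
      (∀ (Z : Scheme.{u}) [IsNormalIntegral Z] (g₂ : Y ⟶ Z) (g₁ : Z ⟶ X₀)
        [IsFinite g₂] [IsDominant g₂] [IsFinite g₁] [IsDominant g₁],
        g₂ ≫ g₁ = g → 1 < degree g₂ →
        IsGaloisProper h g₂ (y ≫ g₂) ∧
          ¬ EmbedsIn (monodromyGroup (h ≫ g₂) (y ≫ g₂)) (MulAut (socle (monodromyGroup h y)))) →
      IsLarge (fun j : Fib g (y ≫ g) => monodromyGroup h j.1) (monKerPi h g (y ≫ g))) ∧
    -- towers of fields `F ⊆ E ⊆ L`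
    (∀ (L : Type v) [Field L] [Algebra F L] [FiniteDimensional F L] (E : IntermediateField F L),
      letI y : E →+* AlgebraicClosure E := algebraMap E (AlgebraicClosure E)
      letI x : F →+* AlgebraicClosure E := y.comp (algebraMap F E)
      IsInvariantIntermediate E →
      SocleNonabelianMinimalNormal (galoisGroup (algebraMap E L) y) →
      IsConjCompatible (fun j : Emb (algebraMap F E) x => galoisGroup (algebraMap E L) j.1)
        (galKerPi (algebraMap F E) (algebraMap E L) x) →
      (∀ (M : IntermediateField F L) (hM : M < E),
        letI i : M →+* E := (IntermediateField.inclusion hM.le).toRingHom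
        galClosure i (y.comp i) < galClosure ((algebraMap E L).comp i) (y.comp i) ∧
          ¬ EmbedsIn (galoisGroup ((algebraMap E L).comp i) (y.comp i))
              (MulAut (socle (galoisGroup (algebraMap E L) y)))) →
      IsLarge (fun j : Emb (algebraMap F E) x => galoisGroup (algebraMap E L) j.1)
        (galKerPi (algebraMap F E) (algebraMap E L) x)) := by 
  refine ⟨?_, fun L _ _ _ E hinv hsoc hcc hM => isLarge_of_isInvariantIntermediate E _
    (algebraMap_isIntegral_iff.mpr inferInstance) hinv hsoc hcc hM⟩
  intro X Y X₀ _ _ _ s _ _ _ h g _ _ _ _ hinv hsoc hcc hZ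
  -- Finite type over `F` is used for the noetherian property, which makes normalizations finite;
  -- the structure morphism embeds `F` in the function field, which therefore has characteristic
  -- zero.
  have : IsLocallyNoetherian X₀ := LocallyOfFiniteType.isLocallyNoetherian s
  have : CharZero X₀.functionField := charZero_of_ringHom
    ((Scheme.ΓSpecIso (.of F)).inv ≫ s.appTop ≫
      X₀.presheaf.germ ⊤ (genericPoint X₀) trivial).hom
  exact isLarge_monKerPi h g _ (algebraMap_isIntegral_iff.mpr inferInstance) rfl hinv hsoc hcc hZ
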